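/- A graphon is a measurable symmetric function $h\colon[0,1]^2\to[0,1]$; $\mathcal W$ is the set of graphons and $\mathcal M$ the set of Lebesgue measure-preserving bijections $\phi$ of $[0,1]$; $h^\phi(x,y)=h(\phi(x),\phi(y))$. Let $$d_\square(h_1,h_2)=\sup_{S,T\subset[0,1]}\Big|\int_{S\times T}[h_1-h_2]\Big|,\qquad \delta_\square(h_1,h_2)=\inf_{\phi\in\mathcal M}d_\square(h_1,h_2^\phi),$$ with $S,T$ measurable, and let $\widetilde{\mathcal W}$ be the quotient of $\mathcal W$ by $\delta_\square=0$, with the metric $\delta_\square$. For $h\in\mathcal W$ let $(\mathcal L_hu)(x)=\int_0^1h(x,y)[u(x)-u(y)]\,dy$ on $L^2([0,1])$, with operator norm $\|\mathcal L_h\|$. Let $r\in\mathcal W$ satisfy $\log r,\ \log(1-r)\in L^1([0,1]^2)$ (with $\log 0=-\infty$; in particular $0<r<1$ almost everywhere). Let $\mathcal R(a\mid b)=a\log\frac ab+(1-a)\log\frac{1-a}{1-b}$ (with $0\log 0=0$), $I_r(h)=\int_{[0,1]^2}\mathcal R(h(x,y)\mid r(x,y))\,dx\,dy$ for $h\in\mathcal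 W$, and $J_r(\widetilde h)=\inf_{\phi\in\mathcal M}I_r(h^\phi)$, where $h$ is any representative of $\widetilde h\in\widetilde{\mathcal W}$. Put $C_r=\|\mathcal L_r\|$, $C_r^0=\int_{[0,1]^2}\log\frac1{1-r}$, and $$\psi_r(\beta)=\inf\{J_r(\widetilde h):\widetilde h\in\widetilde{\mathcal W},\ \|\mathcal L_{\widetilde h}\|\le\beta\},\qquad \beta\in[0,C_r].$$ **Theorem.** The numbers $\|\mathcal L_{\widetilde h}\|=\|\mathcal L_h\|$ and $J_r(\widetilde h)$ do not depend on the representative $h$ of $\widetilde h$, and $\psi_r(\beta)=\inf\{I_r(h):h\in\mathcal W,\ \|\mathcal L_h\|\le\beta\}$ for all $\beta\in[0,C_r]$. Moreover: (i) $\psi_r$ is continuous and strictly decreasing on $[0,C_r]$, with $\psi_r(0)=C_r^0>0$ and $\psi_r(C_r)=0$. (ii) For every $\beta\in[0,C_r]$, the set of minimisers of the variational formula for $\psi_r(\beta)$, that is, of all $\widetilde h\in\widetilde{\mathcal W}$ with $\|\mathcal L_{\widetilde h}\|\le\beta$ at which $J_r$ attains its minimum over this constraint set, is non-empty and compact in $\widetilde{\mathcal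 W}$. -/

import Mathlib

open Set Filter Topology MeasureTheory
open scoped unitInterval

noncomputable section

/-- A graphon: a (Borel) measurable symmetric function `[0,1]² → [0,1]`. -/
@[ext]
structure Graphon where
  toFun : I → I → ℝ
  measurable' : Measurable (Function.uncurry toFun)
  symm' : ∀ x y, toFun x y = toFun y x
  nonneg' : ∀ x y, 0 ≤ toFun x y
  le_one' : ∀ x y, toFun x y ≤ 1

namespace Graphon

instance : CoeFun Graphon (fun _ => I → I → ℝ) := ⟨Graphon.toFun⟩

/-- Lebesgue measure preserving bijections of `[0,1]`. (The inverse of a Borel measurable bijection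
of `[0,1]` is automatically measurable.) -/
def Relabeling : Type := {φ : I ≃ᵐ I // MeasurePreserving φ volume volume}

namespace Relabeling

instance : Coe Relabeling (I ≃ᵐ I) := ⟨Subtype.val⟩

/-- The identity relabeling. -/
def refl : Relabeling := ⟨MeasurableEquiv.refl I, MeasurePreserving.id volume⟩

/-- The inverse relabeling. -/
def symm (φ : Relabeling) : Relabeling := ⟨φ.1.symm, φ.2.symm φ.1⟩

/-- Composition of relabelings, `φ` first. -/
def trans (φ ψ : Relabeling) : Relabeling := ⟨φ.1.trans ψ.1, ψ.2.comp φ.2⟩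

instance : Nonempty Relabeling := ⟨refl⟩

end Relabeling

/-- The relabeled graphon `h^φ (x, y) = h (φ x, φ y)`. -/
def relabel (h : Graphon) (φ : Relabeling) : Graphon where
  toFun x y := h (φ.1 x) (φ.1 y)
  measurable' := h.measurable'.comp (φ.1.measurable.prodMap φ.1.measurable)
  symm' _ _ := h.symm' _ _
  nonneg' _ _ := h.nonneg' _ _
  le_one' _ _ := h.le_one' _ _

/-- The cut distance `d_□(h, k) = sup_{S, T} |∫_{S × T} (h - k)|`, over measurable
`S, T ⊆ [0,1]`. -/
def cutDist (h k : Graphon) : ℝ :=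
  ⨆ A : {S : Set I // MeasurableSet S} × {T : Set I // MeasurableSet T},
    |∫ p in A.1.1 ×ˢ A.2.1, (h p.1 p.2 - k p.1 p.2)|

/-- The cut metric `δ_□(h, k) = inf_φ d_□(h, k^φ)`. -/
def cutMetric (h k : Graphon) : ℝ := ⨅ φ : Relabeling, cutDist h (k.relabel φ)

/-! Facts needed to see that `cutMetric` is a pseudometric. -/

theorem integrable (h : Graphon) (μ : Measure (I × I)) [IsFiniteMeasure μ] :
    Integrable (fun p : I × I => h p.1 p.2) μ :=
  Integrable.of_bound (C := 1) h.measurable'.aestronglyMeasurable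
    (ae_of_all _ fun p => by
      rw [Real.norm_eq_abs, abs_of_nonneg (h.nonneg' _ _)]; exact h.le_one' _ _)

theorem abs_setIntegral_le (h k : Graphon) (A : Set (I × I)) :
    |∫ p in A, (h p.1 p.2 - k p.1 p.2)| ≤ 1 := by
  have h1 : ‖∫ p in A, (h p.1 p.2 - k p.1 p.2)‖ ≤ 1 * volume.real A :=
    norm_setIntegral_le_of_norm_le_const (measure_lt_top _ _) fun p _ => by
      rw [Real.norm_eq_abs, abs_le]
      have := h.nonneg' p.1 p.2
      have := h.le_one' p.1 p.2
      have := k.nonneg' p.1 p.2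
      have := k.le_one' p.1 p.2
      constructor <;> linarith
  have h2 : (volume : Measure (I × I)).real A ≤ 1 := measureReal_le_one
  rw [Real.norm_eq_abs] at h1
  linarith

theorem abs_setIntegral_le_cutDist (h k : Graphon) {S T : Set I} (hS : MeasurableSet S)
    (hT : MeasurableSet T) : |∫ p in S ×ˢ T, (h p.1 p.2 - k p.1 p.2)| ≤ cutDist h k :=
  le_ciSup (f := fun A : {S : Set I // MeasurableSet S} × {T : Set I // MeasurableSet T} =>
      |∫ p in A.1.1 ×ˢ A.2.1, (h p.1 p.2 - k p.1 p.2)|)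
    ⟨1, by rintro _ ⟨A, rfl⟩; exact abs_setIntegral_le h k _⟩ (⟨S, hS⟩, ⟨T, hT⟩)

instance : Nonempty {S : Set I // MeasurableSet S} := ⟨⟨∅, MeasurableSet.empty⟩⟩

theorem cutDist_nonneg (h k : Graphon) : 0 ≤ cutDist h k := Real.iSup_nonneg fun _ => abs_nonneg _

theorem cutDist_self (h : Graphon) : cutDist h h = 0 := by simp [cutDist]

theorem cutDist_comm (h k : Graphon) : cutDist h k = cutDist k h := by
  unfold cutDist
  congr 1
  funext A
  rw [← abs_neg, ← integral_neg]
  simp only [neg_sub]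

theorem cutDist_triangle (h k l : Graphon) : cutDist h l ≤ cutDist h k + cutDist k l := by
  refine ciSup_le fun A => ?_
  have hsum : ∫ p in A.1.1 ×ˢ A.2.1, (h p.1 p.2 - l p.1 p.2)
      = (∫ p in A.1.1 ×ˢ A.2.1, (h p.1 p.2 - k p.1 p.2))
        + ∫ p in A.1.1 ×ˢ A.2.1, (k p.1 p.2 - l p.1 p.2) := by
    rw [integral_sub (h.integrable _) (k.integrable _), integral_sub (k.integrable _)
      (l.integrable _), integral_sub (h.integrable _) (l.integrable _)]
    ring
  rw [hsum]
  exact (abs_add_le _ _).trans (add_le_add (abs_setIntegral_le_cutDist h k A.1.2 A.2.2)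
    (abs_setIntegral_le_cutDist k l A.1.2 A.2.2))

theorem relabel_refl (h : Graphon) : h.relabel Relabeling.refl = h := rfl

theorem relabel_trans (h : Graphon) (φ ψ : Relabeling) :
    h.relabel (φ.trans ψ) = (h.relabel ψ).relabel φ := rfl

theorem relabel_symm_relabel (h : Graphon) (φ : Relabeling) :
    (h.relabel φ.symm).relabel φ = h := by
  ext x y
  simp [relabel, Relabeling.symm]

theorem relabel_relabel_symm (h : Graphon) (φ : Relabeling) :
    (h.relabel φ).relabel φ.symm = h := by
  ext x y
  simp [relabel, Relabeling.symm]

theorem cutDist_relabel_le (h k : Graphon) (φ : Relabeling) :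
    cutDist (h.relabel φ) (k.relabel φ) ≤ cutDist h k := by
  refine ciSup_le fun A => ?_
  have hmp : MeasurePreserving (φ.1.prodCongr φ.1) (volume : Measure (I × I)) volume :=
    φ.2.prod φ.2
  have key := hmp.setIntegral_preimage_emb (φ.1.prodCongr φ.1).measurableEmbedding
    (fun p : I × I => h p.1 p.2 - k p.1 p.2)
    ((φ.1.symm ⁻¹' A.1.1) ×ˢ (φ.1.symm ⁻¹' A.2.1))
  have hset : (φ.1.prodCongr φ.1) ⁻¹' ((φ.1.symm ⁻¹' A.1.1) ×ˢ (φ.1.symm ⁻¹' A.2.1))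
      = A.1.1 ×ˢ A.2.1 := by
    ext p
    simp [MeasurableEquiv.prodCongr]
  rw [hset] at key
  have : ∫ p in A.1.1 ×ˢ A.2.1, ((h.relabel φ) p.1 p.2 - (k.relabel φ) p.1 p.2)
      = ∫ p in (φ.1.symm ⁻¹' A.1.1) ×ˢ (φ.1.symm ⁻¹' A.2.1), (h p.1 p.2 - k p.1 p.2) := key
  rw [this]
  exact abs_setIntegral_le_cutDist h k (φ.1.symm.measurable A.1.2) (φ.1.symm.measurable A.2.2)

theorem cutDist_relabel (h k : Graphon) (φ : Relabeling) :
    cutDist (h.relabel φ) (k.relabel φ) = cutDist h k := by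
  refine le_antisymm (cutDist_relabel_le h k φ) ?_
  have := cutDist_relabel_le (h.relabel φ) (k.relabel φ) φ.symm
  rwa [relabel_relabel_symm, relabel_relabel_symm] at this

theorem cutMetric_le (h k : Graphon) (φ : Relabeling) :
    cutMetric h k ≤ cutDist h (k.relabel φ) :=
  ciInf_le (f := fun φ : Relabeling => cutDist h (k.relabel φ))
    ⟨0, by rintro _ ⟨ψ, rfl⟩; exact cutDist_nonneg _ _⟩ φ

theorem cutMetric_nonneg (h k : Graphon) : 0 ≤ cutMetric h k :=
  Real.iInf_nonneg fun _ => cutDist_nonneg _ _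

theorem cutMetric_self (h : Graphon) : cutMetric h h = 0 :=
  le_antisymm ((cutMetric_le h h Relabeling.refl).trans_eq (cutDist_self h)) (cutMetric_nonneg h h)

theorem cutMetric_comm_le (h k : Graphon) : cutMetric h k ≤ cutMetric k h := by
  refine le_ciInf fun φ => (cutMetric_le h k φ.symm).trans_eq ?_
  rw [← cutDist_relabel _ _ φ, relabel_symm_relabel, cutDist_comm]

theorem cutMetric_triangle (h k l : Graphon) :
    cutMetric h l ≤ cutMetric h k + cutMetric k l := by
  refine le_ciInf_add_ciInf fun φ ψ => ?_
  refine (cutMetric_le h l (φ.trans ψ)).trans ?_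
  rw [relabel_trans, ← cutDist_relabel k (l.relabel ψ) φ]
  exact cutDist_triangle _ _ _

instance : PseudoMetricSpace Graphon where
  dist := cutMetric
  dist_self := cutMetric_self
  dist_comm h k := le_antisymm (cutMetric_comm_le h k) (cutMetric_comm_le k h)
  dist_triangle := cutMetric_triangle

/-- `(ℒ_h u)(x) = ∫ h(x, y) (u(x) - u(y)) dy`. -/
def laplacian (h : Graphon) (u : I → ℝ) (x : I) : ℝ := ∫ y, h x y * (u x - u y)

/-- The operator norm `‖ℒ_h‖ = sup {‖ℒ_h u‖₂ : u ∈ L²([0,1]), ‖u‖₂ = 1}`. The supremum is formed in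
`[0, ∞]`; it is at most `2`. -/
def laplacianNorm (h : Graphon) : ℝ :=
  (⨆ u : {u : I → ℝ // MemLp u 2 volume ∧ eLpNorm u 2 volume = 1},
    eLpNorm (h.laplacian u.1) 2 volume).toReal

theorem eLpNorm_laplacian_le (h : Graphon) {u : I → ℝ} (hu : MemLp u 2 volume) :
    eLpNorm (h.laplacian u) 2 volume ≤ 2 * eLpNorm u 2 volume := by
  have hint : Integrable u volume := hu.integrable (by norm_num)
  have hpt : ∀ x, ‖h.laplacian u x‖ ≤ |u x| + ∫ y, |u y| := fun x => by
    have h1 : ‖h.laplacian u x‖ ≤ ∫ y, (|u x| + |u y|) := by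
      refine norm_integral_le_of_norm_le ((integrable_const _).add hint.abs)
        (ae_of_all _ fun y => ?_)
      rw [norm_mul, Real.norm_eq_abs, Real.norm_eq_abs, abs_of_nonneg (h.nonneg' _ _)]
      exact (mul_le_of_le_one_left (abs_nonneg _) (h.le_one' _ _)).trans (abs_sub _ _)
    rwa [integral_add (integrable_const _) hint.abs, integral_const, probReal_univ, one_smul] at h1
  have hconst : ENNReal.ofReal (∫ y, |u y|) ≤ eLpNorm u 2 volume := by
    have h1 : ENNReal.ofReal (∫ y, |u y|) = eLpNorm u 1 volume := by
      rw [eLpNorm_one_eq_lintegral_enorm, ← ofReal_integral_norm_eq_lintegral_enorm hint]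
      rfl
    rw [h1]
    exact eLpNorm_le_eLpNorm_of_exponent_le (by norm_num) hu.1
  calc eLpNorm (h.laplacian u) 2 volume
      ≤ eLpNorm ((fun x => |u x|) + fun _ : I => ∫ y, |u y|) 2 volume :=
        eLpNorm_mono_real hpt
    _ ≤ eLpNorm (fun x => |u x|) 2 volume + eLpNorm (fun _ : I => ∫ y, |u y|) 2 volume :=
        eLpNorm_add_le hu.abs.1 aestronglyMeasurable_const (by norm_num)
    _ ≤ eLpNorm u 2 volume + eLpNorm u 2 volume := by
        refine add_le_add (eLpNorm_norm u).le ?_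
        rw [eLpNorm_const _ (by norm_num) (NeZero.ne _), measure_univ, ENNReal.one_rpow, mul_one,
          Real.enorm_eq_ofReal (integral_nonneg fun _ => abs_nonneg _)]
        exact hconst
    _ = 2 * eLpNorm u 2 volume := (two_mul _).symm

/-- The supremum that defines `laplacianNorm` is finite. -/
theorem iSup_laplacian_le (h : Graphon) :
    (⨆ u : {u : I → ℝ // MemLp u 2 volume ∧ eLpNorm u 2 volume = 1},
      eLpNorm (h.laplacian u.1) 2 volume) ≤ 2 :=
  iSup_le fun u => (h.eLpNorm_laplacian_le u.2.1).trans_eq (by rw [u.2.2, mul_one])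

end Graphon

/-- `ℛ(a ∣ b) = a log (a / b) + (1 - a) log ((1 - a) / (1 - b))`, the relative entropy of two
Bernoulli distributions (`0 log 0 = 0`). -/
def bernoulliEntropy (a b : ℝ) : ℝ :=
  a * Real.log (a / b) + (1 - a) * Real.log ((1 - a) / (1 - b))

namespace Graphon

/-- `log r` and `log (1 - r)` are in `L¹([0,1]²)`. As `log 0 = -∞` here, this entails that `r` takes
values in `(0, 1)` almost everywhere. -/
structure BasicAssumption (r : Graphon) : Prop where
  mem_Ioo : ∀ᵐ p : I × I, r p.1 p.2 ∈ Ioo (0 : ℝ) 1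
  integrable_log : Integrable (fun p : I × I => Real.log (r p.1 p.2))
  integrable_log_one_sub : Integrable (fun p : I × I => Real.log (1 - r p.1 p.2))

/-- `I_r(h) = ∫ ℛ(h(x, y) ∣ r(x, y)) dx dy`. -/
def entropy (r h : Graphon) : ℝ := ∫ p : I × I, bernoulliEntropy (h p.1 p.2) (r p.1 p.2)

/-- `inf_φ I_r(h^φ)`. -/
def rate (r h : Graphon) : ℝ := ⨅ φ : Relabeling, entropy r (h.relabel φ)

/-- `C_r = ‖ℒ_r‖`. -/
def normConst (r : Graphon) : ℝ := r.laplacianNorm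

/-- `C_r⁰ = ∫ log (1 / (1 - r))`. -/
def zeroConst (r : Graphon) : ℝ := ∫ p : I × I, Real.log (1 / (1 - r p.1 p.2))

end Graphon

/-- The quotient graphon space: graphons up to `δ_□ = 0`, with the metric `δ_□`. -/
abbrev QuotientGraphon : Type := SeparationQuotient Graphon

namespace QuotientGraphon

/-- The class of a graphon. -/
abbrev mk (h : Graphon) : QuotientGraphon := SeparationQuotient.mk h

theorem mk_eq_mk_iff (h k : Graphon) : mk h = mk k ↔ Graphon.cutMetric h k = 0 := by
  rw [SeparationQuotient.mk_eq_mk, Metric.inseparable_iff]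
  rfl

theorem dist_mk (h k : Graphon) : dist (mk h) (mk k) = Graphon.cutMetric h k := rfl

/-- Some representative of a class. -/
def rep (x : QuotientGraphon) : Graphon := Quotient.out x

theorem mk_rep (x : QuotientGraphon) : mk x.rep = x := Quotient.out_eq x

/-- `‖ℒ_x‖`, evaluated at a representative of `x`. -/
def laplacianNorm (x : QuotientGraphon) : ℝ := x.rep.laplacianNorm

/-- `J_r(x) = inf_φ I_r(h^φ)`, where `h` is a representative of `x`. -/
def J (r : Graphon) (x : QuotientGraphon) : ℝ := r.rate x.rep

/-- The constraint set of the variational formula: all `x` with `‖ℒ_x‖ ≤ β`. -/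
def feasible (β : ℝ) : Set QuotientGraphon := {x | x.laplacianNorm ≤ β}

/-- The downward rate function `ψ_r(β) = inf {J_r(x) : ‖ℒ_x‖ ≤ β}`. -/
def psi (r : Graphon) (β : ℝ) : ℝ := sInf (J r '' feasible β)

/-- The minimisers of the variational formula for `ψ_r(β)`. -/
def minimisers (r : Graphon) (β : ℝ) : Set QuotientGraphon :=
  {x | x ∈ feasible β ∧ IsMinOn (J r) (feasible β) x}

end QuotientGraphon

end

noncomputable section

/-! The theorem needs no compactness of the graphon space: it rests on convexity. Both `h ↦ ‖ℒ_h‖`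
and `I_r` are convex under mixing, and `I_r` is uniformly convex in `L²` (`entropy_midpoint`, from a
Pinsker-type bound). Hence near-minimisers of `I_r` under a norm constraint form an `L²`-Cauchy
sequence. Their limit is feasible, since the norm is lower semicontinuous in the cut distance, and
optimal, since `I_r` is continuous under a.e. convergence (`exists_entropy_le_of_tendsto`). With a
constant bound this gives a minimiser; with bounds decreasing to `β` it gives right continuity of
the value function.

The value function is convex and antitone, vanishes at `C_r`, and is positive before it because
`I_r(h) = 0` forces `h = r` a.e.; so it is strictly decreasing. Convexity and monotonicity give the
other half of continuity. At `β = 0` only the zero graphon is feasible, up to null sets. The same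
uniform convexity makes the minimising class unique, so compactness in (ii) is that of a singleton.

Independence of the representative needs more care, since `δ_□(h, k) = 0` only says that relabelings
of `k` approach `h` in cut distance. Cut convergence implies convergence against `L¹` weights, which
handles `‖ℒ_h‖` and the part of `I_r` linear in `h`. What is left is `∫ binEntropy h`: it is
relabeling invariant and upper semicontinuous, hence constant on classes. -/

/-! ### Pointwise inequalities for the Bernoulli relative entropy -/

/-- This is `log x ≤ x - 1` at `x = √b / √a`. Added to its copy for `1 - a`, `1 - b`, the linear
terms cancel and relative entropy dominates a squared Hellinger distance. -/
theorem mul_log_div_ge {a b : ℝ} (ha : 0 ≤ a) (hb : 0 < b) :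
    (√a - √b) ^ 2 + a - b ≤ a * Real.log (a / b) := by
  rcases ha.eq_or_lt with rfl | ha
  · simp [Real.sq_sqrt hb.le]
  · have h1 : Real.log (√b / √a) ≤ √b / √a - 1 := Real.log_le_sub_one_of_pos (by positivity)
    have h2 : Real.log (a / b) = -2 * Real.log (√b / √a) := by
      rw [Real.log_div (by positivity) (by positivity), Real.log_div (by positivity) (by positivity),
        Real.log_sqrt ha.le, Real.log_sqrt hb.le]
      ring
    have h3 : a * (√b / √a) = √a * √b := by
      have : √a ≠ 0 := by positivity
      field_simp
      rw [Real.sq_sqrt ha.le]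
    have h4 : a * Real.log (√b / √a) ≤ √a * √b - a := by
      rw [← h3]
      nlinarith
    rw [h2]
    nlinarith [Real.sq_sqrt ha.le, Real.sq_sqrt hb.le]

theorem sq_sub_le_sq_sqrt_sub {a b : ℝ} (ha : a ∈ Icc (0 : ℝ) 1) (hb : b ∈ Icc (0 : ℝ) 1) :
    (a - b) ^ 2 / 4 ≤ (√a - √b) ^ 2 := by
  have h1 : √a ≤ 1 := Real.sqrt_le_one.2 ha.2
  have h2 : √b ≤ 1 := Real.sqrt_le_one.2 hb.2
  have h3 : a - b = (√a - √b) * (√a + √b) := by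
    ring_nf
    rw [Real.sq_sqrt ha.1, Real.sq_sqrt hb.1]
  have h4 : (√a + √b) ^ 2 ≤ 4 := by nlinarith [Real.sqrt_nonneg a, Real.sqrt_nonneg b]
  rw [h3, mul_pow]
  nlinarith [mul_le_mul_of_nonneg_left h4 (sq_nonneg (√a - √b))]

/-- A Pinsker-type inequality. -/
theorem sq_le_bernoulliEntropy {a b : ℝ} (ha : a ∈ Icc (0 : ℝ) 1) (hb : b ∈ Ioo (0 : ℝ) 1) :
    (a - b) ^ 2 / 2 ≤ bernoulliEntropy a b := by
  have h1 := mul_log_div_ge ha.1 hb.1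
  have h2 := mul_log_div_ge (a := 1 - a) (b := 1 - b) (by linarith [ha.2]) (by linarith [hb.2])
  have h3 := sq_sub_le_sq_sqrt_sub ha ⟨hb.1.le, hb.2.le⟩
  have h4 := sq_sub_le_sq_sqrt_sub (a := 1 - a) (b := 1 - b) ⟨by linarith [ha.2], by linarith [ha.1]⟩
    ⟨by linarith [hb.2], by linarith [hb.1]⟩
  have h5 : (1 - a - (1 - b)) ^ 2 = (a - b) ^ 2 := by ring
  rw [h5] at h4
  unfold bernoulliEntropy
  linarith

theorem bernoulliEntropy_eq {b : ℝ} (a : ℝ) (hb : b ∈ Ioo (0 : ℝ) 1) :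
    bernoulliEntropy a b
      = -Real.binEntropy a - a * Real.log b - (1 - a) * Real.log (1 - b) := by
  have key : ∀ x y : ℝ, 0 < y → x * Real.log (x / y) = x * Real.log x - x * Real.log y := by
    intro x y hy
    rcases eq_or_ne x 0 with rfl | hx
    · simp
    · rw [Real.log_div hx hy.ne', mul_sub]
  rw [bernoulliEntropy, key _ _ hb.1, key _ _ (by linarith [hb.2]), Real.binEntropy_eq_negMulLog_add_negMulLog_one_sub]
  simp only [Real.negMulLog]
  ring

theorem bernoulliEntropy_self {a : ℝ} (ha : a ∈ Ioo (0 : ℝ) 1) : bernoulliEntropy a a = 0 := by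
  have h1 : a ≠ 0 := ha.1.ne'
  have h2 : 1 - a ≠ 0 := by linarith [ha.2]
  simp [bernoulliEntropy, div_self h1, div_self h2]

theorem bernoulliEntropy_zero_left (b : ℝ) : bernoulliEntropy 0 b = Real.log (1 / (1 - b)) := by
  simp [bernoulliEntropy]

theorem bernoulliEntropy_convex {a a' b t : ℝ} (ha : a ∈ Icc (0 : ℝ) 1) (ha' : a' ∈ Icc (0 : ℝ) 1)
    (hb : b ∈ Ioo (0 : ℝ) 1) (ht : t ∈ Icc (0 : ℝ) 1) :
    bernoulliEntropy ((1 - t) * a + t * a') b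
      ≤ (1 - t) * bernoulliEntropy a b + t * bernoulliEntropy a' b := by
  have h := Real.strictConcave_binEntropy.concaveOn.2 ha ha' (sub_nonneg.2 ht.2) ht.1
    (sub_add_cancel 1 t)
  simp only [smul_eq_mul] at h
  rw [bernoulliEntropy_eq _ hb, bernoulliEntropy_eq _ hb, bernoulliEntropy_eq _ hb]
  linarith

/-- The terms in `b` are affine in the first argument, so the convexity gap does not depend on `b`:
it is the mean of `ℛ(a ∣ m)` and `ℛ(a' ∣ m)` at the midpoint `m`. Each is at least `(a - a')² / 8`
by the Pinsker-type bound. -/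
theorem bernoulliEntropy_midpoint {a a' b : ℝ} (ha : a ∈ Icc (0 : ℝ) 1) (ha' : a' ∈ Icc (0 : ℝ) 1)
    (hb : b ∈ Ioo (0 : ℝ) 1) :
    bernoulliEntropy ((1 - 1 / 2) * a + 1 / 2 * a') b + (a - a') ^ 2 / 8
      ≤ (bernoulliEntropy a b + bernoulliEntropy a' b) / 2 := by
  set m := (1 - 1 / 2) * a + 1 / 2 * a' with hm
  by_cases hmI : m ∈ Ioo (0 : ℝ) 1
  · have h1 := sq_le_bernoulliEntropy ha hmI
    have h2 := sq_le_bernoulliEntropy ha' hmI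
    rw [bernoulliEntropy_eq _ hmI] at h1 h2
    rw [bernoulliEntropy_eq _ hb, bernoulliEntropy_eq _ hb, bernoulliEntropy_eq _ hb]
    have h3 : Real.binEntropy m = -(m * Real.log m) - (1 - m) * Real.log (1 - m) := by
      rw [Real.binEntropy_eq_negMulLog_add_negMulLog_one_sub]
      simp only [Real.negMulLog]
      ring
    rw [h3]
    have h4 : (a - m) ^ 2 / 2 = (a - a') ^ 2 / 8 := by rw [hm]; ring
    have h5 : (a' - m) ^ 2 / 2 = (a - a') ^ 2 / 8 := by rw [hm]; ring
    rw [h4] at h1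
    rw [h5] at h2
    have h6 : m * Real.log m = (a * Real.log m + a' * Real.log m) / 2 := by
      nth_rewrite 1 [hm]; ring
    have h7 : (1 - m) * Real.log (1 - m)
        = ((1 - a) * Real.log (1 - m) + (1 - a') * Real.log (1 - m)) / 2 := by
      nth_rewrite 1 [hm]; ring
    have h8 : m * Real.log b = (a * Real.log b + a' * Real.log b) / 2 := by
      rw [hm]; ring
    have h9 : (1 - m) * Real.log (1 - b)
        = ((1 - a) * Real.log (1 - b) + (1 - a') * Real.log (1 - b)) / 2 := by
      rw [hm]; ring
    rw [h6, h7, h8, h9]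
    linarith
  -- A midpoint equal to `0` or `1` forces both ends to coincide.
  · have h1 : a = a' := by
      by_contra hne
      apply hmI
      rcases lt_or_gt_of_ne hne with h | h
      · constructor <;> linarith [ha.1, ha.2, ha'.1, ha'.2]
      · constructor <;> linarith [ha.1, ha.2, ha'.1, ha'.2]
    have h2 : m = a := by rw [hm, ← h1]; ring
    rw [h2, ← h1]
    linarith [sq_nonneg (a - a), sub_self a, show (a - a) ^ 2 / 8 = 0 by ring]

/-! ### The entropy functional: convexity and continuity -/

namespace Graphon

theorem mem_Icc (h : Graphon) (x y : I) : h x y ∈ Icc (0 : ℝ) 1 := ⟨h.nonneg' x y, h.le_one' x y⟩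

theorem measurable (h : Graphon) : Measurable (fun p : I × I => h p.1 p.2) := h.measurable'

theorem abs_sub_le_one (h k : Graphon) (x y : I) : |h x y - k x y| ≤ 1 := by
  have h1 := h.mem_Icc x y
  have h2 := k.mem_Icc x y
  rw [abs_le]
  constructor <;> linarith [h1.1, h1.2, h2.1, h2.2]

/-- The convex combination `(1 - t) h + t k`. -/
def mix (h k : Graphon) (t : ℝ) (ht : t ∈ Icc (0 : ℝ) 1) : Graphon where
  toFun x y := (1 - t) * h x y + t * k x y
  measurable' := by
    have h1 := h.measurable
    have h2 := k.measurable
    simp only [Function.uncurry_def]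
    fun_prop
  symm' x y := by rw [h.symm', k.symm']
  nonneg' x y := add_nonneg (mul_nonneg (sub_nonneg.2 ht.2) (h.nonneg' _ _))
    (mul_nonneg ht.1 (k.nonneg' _ _))
  le_one' x y := by nlinarith [h.le_one' x y, k.le_one' x y, ht.1, ht.2]

/-- The constant graphon. -/
def const (c : ℝ) (hc : c ∈ Icc (0 : ℝ) 1) : Graphon where
  toFun _ _ := c
  measurable' := measurable_const
  symm' _ _ := rfl
  nonneg' _ _ := hc.1
  le_one' _ _ := hc.2

instance : Zero Graphon := ⟨const 0 ⟨le_rfl, zero_le_one⟩⟩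

theorem zero_apply (x y : I) : (0 : Graphon) x y = 0 := rfl

theorem integrable_mul (h : Graphon) {f : I × I → ℝ} (hf : Integrable f) :
    Integrable (fun p : I × I => f p * h p.1 p.2) :=
  hf.mul_bdd (c := 1) h.measurable.aestronglyMeasurable
    (ae_of_all _ fun p => by
      rw [Real.norm_eq_abs, abs_of_nonneg (h.nonneg' _ _)]; exact h.le_one' _ _)

theorem norm_binEntropy_le (h : Graphon) (x y : I) :
    ‖Real.binEntropy (h x y)‖ ≤ Real.log 2 := by
  rw [Real.norm_eq_abs, abs_of_nonneg (Real.binEntropy_nonneg (h.nonneg' _ _) (h.le_one' _ _))]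
  exact Real.binEntropy_le_log_two

theorem integrable_binEntropy (h : Graphon) :
    Integrable (fun p : I × I => Real.binEntropy (h p.1 p.2)) :=
  Integrable.of_bound (C := Real.log 2)
    (Real.binEntropy_continuous.measurable.comp h.measurable).aestronglyMeasurable
    (ae_of_all _ fun _ => h.norm_binEntropy_le _ _)

theorem integrable_cross {r : Graphon} (hr : r.BasicAssumption) (h : Graphon) :
    Integrable (fun p : I × I =>
      (Real.log (1 - r p.1 p.2) - Real.log (r p.1 p.2)) * h p.1 p.2) :=
  h.integrable_mul (hr.integrable_log_one_sub.sub hr.integrable_log)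

theorem bernoulliEntropy_ae_eq {r : Graphon} (hr : r.BasicAssumption) (h : Graphon) :
    (fun p : I × I => bernoulliEntropy (h p.1 p.2) (r p.1 p.2)) =ᵐ[volume]
      fun p => (Real.log (1 - r p.1 p.2) - Real.log (r p.1 p.2)) * h p.1 p.2
        - Real.binEntropy (h p.1 p.2) - Real.log (1 - r p.1 p.2) := by
  filter_upwards [hr.mem_Ioo] with p hp
  rw [bernoulliEntropy_eq _ hp]
  ring

theorem integrable_bernoulliEntropy {r : Graphon} (hr : r.BasicAssumption) (h : Graphon) :
    Integrable (fun p : I × I => bernoulliEntropy (h p.1 p.2) (r p.1 p.2)) :=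
  (((integrable_cross hr h).sub h.integrable_binEntropy).sub hr.integrable_log_one_sub).congr
    (bernoulliEntropy_ae_eq hr h).symm

/-- Splits `I_r` into a term linear in `h` with an `L¹` weight (continuous for cut convergence), a
relabeling-invariant term and a constant. -/
theorem entropy_eq {r : Graphon} (hr : r.BasicAssumption) (h : Graphon) :
    r.entropy h = (∫ p : I × I, (Real.log (1 - r p.1 p.2) - Real.log (r p.1 p.2)) * h p.1 p.2)
      - (∫ p : I × I, Real.binEntropy (h p.1 p.2)) - ∫ p : I × I, Real.log (1 - r p.1 p.2) := by
  have h1 : Integrable (fun p : I × I =>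
      (Real.log (1 - r p.1 p.2) - Real.log (r p.1 p.2)) * h p.1 p.2
        - Real.binEntropy (h p.1 p.2)) := (integrable_cross hr h).sub h.integrable_binEntropy
  rw [entropy, integral_congr_ae (bernoulliEntropy_ae_eq hr h),
    integral_sub h1 hr.integrable_log_one_sub,
    integral_sub (integrable_cross hr h) h.integrable_binEntropy]

theorem integrable_sq_sub (h k : Graphon) :
    Integrable (fun p : I × I => (h p.1 p.2 - k p.1 p.2) ^ 2) :=
  Integrable.of_bound (C := 1) ((h.measurable.sub k.measurable).pow_const 2).aestronglyMeasurable
    (ae_of_all _ fun p => by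
      rw [Real.norm_eq_abs, abs_pow]
      exact pow_le_one₀ (abs_nonneg _) (abs_sub_le_one h k _ _))

/-- The squared `L²` distance. -/
def sqDist (h k : Graphon) : ℝ := ∫ p : I × I, (h p.1 p.2 - k p.1 p.2) ^ 2

theorem sqDist_nonneg (h k : Graphon) : 0 ≤ sqDist h k := integral_nonneg fun _ => sq_nonneg _

theorem sqDist_le_entropy {r : Graphon} (hr : r.BasicAssumption) (h : Graphon) :
    sqDist h r / 2 ≤ r.entropy h := by
  rw [sqDist, ← integral_div]
  refine integral_mono_ae ((integrable_sq_sub h r).div_const _) (integrable_bernoulliEntropy hr h) ?_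
  filter_upwards [hr.mem_Ioo] with p hp
  exact sq_le_bernoulliEntropy (h.mem_Icc _ _) hp

theorem entropy_nonneg {r : Graphon} (hr : r.BasicAssumption) (h : Graphon) : 0 ≤ r.entropy h :=
  le_trans (by have := sqDist_nonneg h r; positivity) (sqDist_le_entropy hr h)

theorem entropy_self {r : Graphon} (hr : r.BasicAssumption) : r.entropy r = 0 := by
  refine integral_eq_zero_of_ae ?_
  filter_upwards [hr.mem_Ioo] with p hp
  exact bernoulliEntropy_self hp

theorem entropy_congr_ae (r : Graphon) {h k : Graphon}
    (hk : ∀ᵐ p : I × I, h p.1 p.2 = k p.1 p.2) : r.entropy h = r.entropy k := by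
  refine integral_congr_ae ?_
  filter_upwards [hk] with p hp
  rw [hp]

theorem entropy_zero (r : Graphon) : r.entropy 0 = r.zeroConst := by
  simp only [entropy, zeroConst, zero_apply, bernoulliEntropy_zero_left]

theorem zeroConst_pos {r : Graphon} (hr : r.BasicAssumption) : 0 < r.zeroConst := by
  have hae : ∀ᵐ p : I × I, 0 < Real.log (1 / (1 - r p.1 p.2)) := by
    filter_upwards [hr.mem_Ioo] with p hp
    apply Real.log_pos
    rw [lt_div_iff₀ (by linarith [hp.2])]
    linarith [hp.1]
  have hint : Integrable (fun p : I × I => Real.log (1 / (1 - r p.1 p.2))) := by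
    simp only [one_div, Real.log_inv]
    exact hr.integrable_log_one_sub.neg
  refine (integral_pos_iff_support_of_nonneg_ae (hae.mono fun _ h => h.le) hint).2 ?_
  have : (Function.support fun p : I × I => Real.log (1 / (1 - r p.1 p.2))) =ᵐ[volume] univ :=
    eventuallyEq_univ.2 (hae.mono fun _ h => h.ne')
  rw [measure_congr this]
  simp

theorem entropy_mix_le {r : Graphon} (hr : r.BasicAssumption) (h k : Graphon) {t : ℝ}
    (ht : t ∈ Icc (0 : ℝ) 1) :
    r.entropy (mix h k t ht) ≤ (1 - t) * r.entropy h + t * r.entropy k := by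
  simp only [entropy]
  rw [← integral_const_mul, ← integral_const_mul, ← integral_add
    ((integrable_bernoulliEntropy hr h).const_mul _) ((integrable_bernoulliEntropy hr k).const_mul _)]
  refine integral_mono_ae (integrable_bernoulliEntropy hr _)
    (((integrable_bernoulliEntropy hr h).const_mul _).add
      ((integrable_bernoulliEntropy hr k).const_mul _)) ?_
  filter_upwards [hr.mem_Ioo] with p hp
  exact bernoulliEntropy_convex (h.mem_Icc _ _) (k.mem_Icc _ _) hp ht

theorem half_mem_Icc : (1 / 2 : ℝ) ∈ Icc (0 : ℝ) 1 := by constructor <;> norm_num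

theorem entropy_midpoint {r : Graphon} (hr : r.BasicAssumption) (h k : Graphon) :
    r.entropy (mix h k (1 / 2) half_mem_Icc) + sqDist h k / 8
      ≤ (r.entropy h + r.entropy k) / 2 := by
  simp only [entropy, sqDist]
  rw [← integral_add (integrable_bernoulliEntropy hr h) (integrable_bernoulliEntropy hr k),
    ← integral_div, ← integral_div, ← integral_add (integrable_bernoulliEntropy hr _)
    ((integrable_sq_sub h k).div_const _)]
  refine integral_mono_ae ((integrable_bernoulliEntropy hr _).add
    ((integrable_sq_sub h k).div_const _)) (((integrable_bernoulliEntropy hr h).add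
    (integrable_bernoulliEntropy hr k)).div_const _) ?_
  filter_upwards [hr.mem_Ioo] with p hp
  exact bernoulliEntropy_midpoint (h.mem_Icc _ _) (k.mem_Icc _ _) hp

/-- Dominated convergence: the linear part is bounded by its integrable weight, the binary entropy
by `log 2`. -/
theorem tendsto_entropy_of_ae {r : Graphon} (hr : r.BasicAssumption) {h : ℕ → Graphon} {k : Graphon}
    (hk : ∀ᵐ p : I × I, Tendsto (fun n => h n p.1 p.2) atTop (𝓝 (k p.1 p.2))) :
    Tendsto (fun n => r.entropy (h n)) atTop (𝓝 (r.entropy k)) := by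
  simp only [entropy_eq hr]
  have hf : Integrable (fun p : I × I => Real.log (1 - r p.1 p.2) - Real.log (r p.1 p.2)) :=
    hr.integrable_log_one_sub.sub hr.integrable_log
  refine (Tendsto.sub ?_ ?_).sub_const _
  · refine tendsto_integral_of_dominated_convergence _
      (fun n => (integrable_cross hr (h n)).aestronglyMeasurable) hf.norm
      (fun n => ae_of_all _ fun p => ?_) (hk.mono fun p hp => hp.const_mul _)
    rw [norm_mul, Real.norm_eq_abs (h n p.1 p.2), abs_of_nonneg ((h n).nonneg' _ _)]
    exact mul_le_of_le_one_right (norm_nonneg _) ((h n).le_one' _ _)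
  · exact tendsto_integral_of_dominated_convergence (fun _ => Real.log 2)
      (fun n => (h n).integrable_binEntropy.aestronglyMeasurable) (integrable_const _)
      (fun n => ae_of_all _ fun p => (h n).norm_binEntropy_le _ _)
      (hk.mono fun p hp => (Real.binEntropy_continuous.tendsto _).comp hp)

/-! ### Cut convergence and weak convergence -/

/-- The cut distance is dominated by the `L²` distance. -/
theorem cutDist_le_sqrt_sqDist (h k : Graphon) : cutDist h k ≤ √(sqDist h k) := by
  refine ciSup_le fun A => Real.le_sqrt_of_sq_le ?_
  have hint : Integrable (fun p : I × I => h p.1 p.2 - k p.1 p.2) :=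
    (h.integrable _).sub (k.integrable _)
  set d : ℝ := ∫ p : I × I, |h p.1 p.2 - k p.1 p.2| with hd
  have h0 : 0 ≤ d := integral_nonneg fun _ => abs_nonneg _
  have h1 : |∫ p in A.1.1 ×ˢ A.2.1, (h p.1 p.2 - k p.1 p.2)| ≤ d :=
    (abs_integral_le_integral_abs).trans
      (setIntegral_le_integral hint.abs (ae_of_all _ fun _ => abs_nonneg _))
  have h2 : d ^ 2 ≤ sqDist h k := by
    -- The variance of `|h - k|` is nonnegative; expanding it gives `d² ≤ ∫ (h - k)²`.
    have h3 : 0 ≤ ∫ p : I × I, (|h p.1 p.2 - k p.1 p.2| - d) ^ 2 :=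
      integral_nonneg fun _ => sq_nonneg _
    have h4 : (fun p : I × I => (|h p.1 p.2 - k p.1 p.2| - d) ^ 2)
        = fun p => (h p.1 p.2 - k p.1 p.2) ^ 2 - (2 * d) * |h p.1 p.2 - k p.1 p.2| + d ^ 2 := by
      funext p
      rw [← sq_abs (h p.1 p.2 - k p.1 p.2)]
      ring
    have h5 : Integrable (fun p : I × I =>
        (h p.1 p.2 - k p.1 p.2) ^ 2 - (2 * d) * |h p.1 p.2 - k p.1 p.2|) :=
      (integrable_sq_sub h k).sub (hint.abs.const_mul _)
    rw [h4, integral_add h5 (integrable_const _),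
      integral_sub (integrable_sq_sub h k) (hint.abs.const_mul _), integral_const_mul,
      integral_const, probReal_univ, one_smul, ← hd] at h3
    rw [sqDist]
    nlinarith
  rw [sq_abs]
  calc _ = |∫ p in A.1.1 ×ˢ A.2.1, (h p.1 p.2 - k p.1 p.2)| ^ 2 := (sq_abs _).symm
    _ ≤ d ^ 2 := pow_le_pow_left₀ (abs_nonneg _) h1 2
    _ ≤ _ := h2

theorem integrable_sub (h k : Graphon) : Integrable (fun p : I × I => h p.1 p.2 - k p.1 p.2) :=
  (h.integrable _).sub (k.integrable _)

theorem norm_setIntegral_sub_le (h k : Graphon) (A : Set (I × I)) :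
    ‖∫ p in A, (h p.1 p.2 - k p.1 p.2)‖ ≤ volume.real A := by
  refine (norm_setIntegral_le_of_norm_le_const (C := 1) (measure_lt_top _ _) fun p _ => ?_).trans_eq
    (one_mul _)
  exact abs_sub_le_one h k _ _

/-- The cut distance controls rectangles, which form a generating π-system. Disjoint unions pass to
the limit because `|h - k| ≤ 1` bounds the terms by the summable measures of the pieces. -/
theorem tendsto_setIntegral_sub {h : ℕ → Graphon} {k : Graphon}
    (hc : Tendsto (fun n => cutDist (h n) k) atTop (𝓝 0)) {A : Set (I × I)} (hA : MeasurableSet A) :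
    Tendsto (fun n => ∫ p in A, (h n p.1 p.2 - k p.1 p.2)) atTop (𝓝 0) := by
  have hrect : ∀ S T : Set I, MeasurableSet S → MeasurableSet T →
      Tendsto (fun n => ∫ p in S ×ˢ T, (h n p.1 p.2 - k p.1 p.2)) atTop (𝓝 0) := fun S T hS hT =>
    squeeze_zero_norm (fun n => abs_setIntegral_le_cutDist (h n) k hS hT) hc
  induction A, hA using MeasurableSpace.induction_on_inter generateFrom_prod.symm isPiSystem_prod with
  | empty => simp
  | basic A hA =>
    obtain ⟨S, hS, T, hT, rfl⟩ := hA
    exact hrect S T hS hT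
  | compl A hA ih =>
    have h1 := (hrect univ univ .univ .univ).sub ih
    simp only [univ_prod_univ, setIntegral_univ, sub_zero] at h1
    refine h1.congr fun n => ?_
    rw [← integral_add_compl hA (integrable_sub (h n) k)]
    ring
  | iUnion A hd hA ih =>
    have hs : Summable fun i => volume.real (A i) := by
      refine ENNReal.summable_toReal ?_
      rw [← measure_iUnion hd hA]
      exact measure_ne_top _ _
    have h1 := tendsto_tsum_of_dominated_convergence hs ih
      (Eventually.of_forall fun n i => norm_setIntegral_sub_le (h n) k (A i))
    rw [tsum_zero] at h1
    refine h1.congr fun n => ?_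
    rw [integral_iUnion hA hd (integrable_sub (h n) k).integrableOn]

theorem norm_integral_mul_sub_le (h k : Graphon) {f : I × I → ℝ} (hf : Integrable f) :
    ‖∫ p : I × I, f p * (h p.1 p.2 - k p.1 p.2)‖ ≤ ∫ p, ‖f p‖ := by
  refine norm_integral_le_of_norm_le hf.norm (ae_of_all _ fun p => ?_)
  rw [norm_mul]
  exact mul_le_of_le_one_right (norm_nonneg _) (abs_sub_le_one h k _ _)

theorem integrable_mul_sub (h k : Graphon) {f : I × I → ℝ} (hf : Integrable f) :
    Integrable (fun p : I × I => f p * (h p.1 p.2 - k p.1 p.2)) := by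
  simp only [mul_sub]
  exact (h.integrable_mul hf).sub (k.integrable_mul hf)

theorem tendsto_integral_mul_sub {h : ℕ → Graphon} {k : Graphon}
    (hc : Tendsto (fun n => cutDist (h n) k) atTop (𝓝 0)) {f : I × I → ℝ} (hf : Integrable f) :
    Tendsto (fun n => ∫ p : I × I, f p * (h n p.1 p.2 - k p.1 p.2)) atTop (𝓝 0) := by
  refine Integrable.induction
    (fun f => Tendsto (fun n => ∫ p : I × I, f p * (h n p.1 p.2 - k p.1 p.2)) atTop (𝓝 0))
    ?_ ?_ ?_ ?_ hf
  · intro c s hs _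
    have h1 := (tendsto_setIntegral_sub hc hs).const_mul c
    rw [mul_zero] at h1
    refine h1.congr fun n => ?_
    rw [← integral_indicator hs, ← integral_const_mul]
    refine integral_congr_ae (ae_of_all _ fun p => ?_)
    by_cases hp : p ∈ s <;> simp [hp]
  · intro f g _ hf hg ihf ihg
    have h1 := ihf.add ihg
    rw [add_zero] at h1
    refine h1.congr fun n => ?_
    rw [← integral_add (integrable_mul_sub _ _ hf) (integrable_mul_sub _ _ hg)]
    simp only [Pi.add_apply, add_mul]
  -- Since `|h n - k| ≤ 1`, replacing `f` by a nearby `g` changes the integral by at most `‖f -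
  -- g‖₁`, uniformly in `n`.
  · refine isClosed_of_closure_subset fun f hf => ?_
    rw [mem_ofPred_eq, Metric.tendsto_atTop]
    intro ε hε
    obtain ⟨g, hg, hfg⟩ := Metric.mem_closure_iff.1 hf (ε / 2) (by positivity)
    obtain ⟨N, hN⟩ := Metric.tendsto_atTop.1 hg (ε / 2) (by positivity)
    refine ⟨N, fun n hn => ?_⟩
    have h1 := hN n hn
    have hfi := L1.integrable_coeFn f
    have hgi := L1.integrable_coeFn g
    have h2 := norm_integral_mul_sub_le (h n) k (hfi.sub hgi)
    have h3 : ∫ p, ‖(⇑f - ⇑g) p‖ = dist f g := by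
      rw [dist_eq_norm, L1.norm_eq_integral_norm]
      refine integral_congr_ae ?_
      filter_upwards [Lp.coeFn_sub f g] with p hp
      rw [hp]
    have h4 : ∫ p : I × I, (⇑f - ⇑g) p * (h n p.1 p.2 - k p.1 p.2)
        = (∫ p : I × I, f p * (h n p.1 p.2 - k p.1 p.2))
          - ∫ p : I × I, g p * (h n p.1 p.2 - k p.1 p.2) := by
      rw [← integral_sub (integrable_mul_sub _ _ hfi) (integrable_mul_sub _ _ hgi)]
      simp only [Pi.sub_apply, sub_mul]
    rw [h3, h4] at h2
    rw [dist_zero_right] at h1 ⊢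
    calc _ = ‖((∫ p : I × I, f p * (h n p.1 p.2 - k p.1 p.2))
          - ∫ p : I × I, g p * (h n p.1 p.2 - k p.1 p.2))
          + ∫ p : I × I, g p * (h n p.1 p.2 - k p.1 p.2)‖ := by rw [sub_add_cancel]
      _ ≤ _ := norm_add_le _ _
      _ < ε / 2 + ε / 2 := add_lt_add (h2.trans_lt hfg) h1
      _ = ε := add_halves ε
  · intro f g hfg _ ih
    refine ih.congr fun n => integral_congr_ae ?_
    filter_upwards [hfg] with p hp
    rw [hp]

/-- Convergence in cut distance implies weak convergence against integrable functions. -/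
theorem tendsto_integral_mul_of_cutDist {h : ℕ → Graphon} {k : Graphon}
    (hc : Tendsto (fun n => cutDist (h n) k) atTop (𝓝 0)) {f : I × I → ℝ} (hf : Integrable f) :
    Tendsto (fun n => ∫ p : I × I, f p * h n p.1 p.2) atTop (𝓝 (∫ p : I × I, f p * k p.1 p.2)) := by
  have h1 := (tendsto_integral_mul_sub hc hf).add_const (∫ p : I × I, f p * k p.1 p.2)
  rw [zero_add] at h1
  refine h1.congr fun n => ?_
  rw [← integral_add (integrable_mul_sub _ _ hf) (k.integrable_mul hf)]
  refine integral_congr_ae (ae_of_all _ fun p => ?_)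
  simp only
  ring

end Graphon

/-! ### The Laplacian and its operator norm -/

theorem abs_integral_mul_le_eLpNorm {α : Type*} [MeasurableSpace α] {μ : Measure α} {f g : α → ℝ}
    (hf : MemLp f 2 μ) (hg : MemLp g 2 μ) :
    |∫ x, f x * g x ∂μ| ≤ (eLpNorm f 2 μ).toReal * (eLpNorm g 2 μ).toReal := by
  have h1 := abs_real_inner_le_norm (hg.toLp g) (hf.toLp f)
  rw [L2.inner_def, Lp.norm_toLp, Lp.norm_toLp, mul_comm] at h1
  refine le_of_eq_of_le (congrArg abs (integral_congr_ae ?_)) h1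
  filter_upwards [hf.coeFn_toLp, hg.coeFn_toLp] with x hx hy
  rw [hx, hy]
  simp

theorem integral_mul_self_eq_sq_eLpNorm {α : Type*} [MeasurableSpace α] {μ : Measure α} {f : α → ℝ}
    (hf : MemLp f 2 μ) : ∫ x, f x * f x ∂μ = (eLpNorm f 2 μ).toReal ^ 2 := by
  have h1 := real_inner_self_eq_norm_sq (hf.toLp f)
  rw [L2.inner_def, Lp.norm_toLp] at h1
  rw [← h1]
  refine integral_congr_ae ?_
  filter_upwards [hf.coeFn_toLp] with x hx
  rw [hx]
  simp [sq]

namespace Graphon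

theorem measurable_section (h : Graphon) (x : I) : Measurable (h x) :=
  h.measurable'.of_uncurry_left

theorem integrable_section (h : Graphon) (x : I) : Integrable (h x) :=
  Integrable.of_bound (C := 1) (h.measurable_section x).aestronglyMeasurable
    (ae_of_all _ fun y => by
      rw [Real.norm_eq_abs, abs_of_nonneg (h.nonneg' _ _)]; exact h.le_one' _ _)

theorem integrable_section_mul (h : Graphon) (x : I) {u : I → ℝ} (hu : Integrable u) :
    Integrable (fun y => h x y * u y) :=
  hu.bdd_mul (c := 1) (h.measurable_section x).aestronglyMeasurable
    (ae_of_all _ fun y => by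
      rw [Real.norm_eq_abs, abs_of_nonneg (h.nonneg' _ _)]; exact h.le_one' _ _)

theorem laplacian_eq (h : Graphon) {u : I → ℝ} (hu : Integrable u) (x : I) :
    h.laplacian u x = (∫ y, h x y) * u x - ∫ y, h x y * u y := by
  simp only [laplacian, mul_sub]
  rw [integral_sub ((h.integrable_section x).mul_const _) (h.integrable_section_mul x hu),
    integral_mul_const]

theorem memLp_laplacian (h : Graphon) {u : I → ℝ} (hu : MemLp u 2 volume) :
    MemLp (h.laplacian u) 2 volume := by
  have hint : Integrable u volume := hu.integrable (by norm_num)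
  refine ⟨?_, (h.eLpNorm_laplacian_le hu).trans_lt
    (ENNReal.mul_lt_top (by simp) hu.2)⟩
  have h1 : h.laplacian u = fun x => (∫ y, h x y) * u x - ∫ y, h x y * u y :=
    funext fun x => h.laplacian_eq hint x
  rw [h1]
  have h2 : AEStronglyMeasurable (fun x : I => ∫ y, h x y) volume :=
    (h.measurable.stronglyMeasurable.integral_prod_right').aestronglyMeasurable
  have h3 : AEStronglyMeasurable (fun p : I × I => h p.1 p.2 * u p.2) (volume.prod volume) :=
    h.measurable.aestronglyMeasurable.mul hu.1.comp_snd
  exact (h2.mul hu.1).sub h3.integral_prod_right'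

theorem integrable_pairing {u g : I → ℝ} (hu : MemLp u 2 volume) (hg : MemLp g 2 volume) :
    Integrable (fun p : I × I => (u p.1 - u p.2) * g p.1) := by
  have h1 : Integrable (fun x => u x * g x) volume := hu.integrable_mul hg
  have h2 : Integrable (fun p : I × I => g p.1 * u p.2) (volume.prod volume) :=
    (hg.integrable (by norm_num)).mul_prod (hu.integrable (by norm_num))
  refine ((h1.comp_fst volume).sub h2).congr (ae_of_all _ fun p => ?_)
  simp only [Pi.sub_apply]
  ring

/-- Fubini turns the pairing into an integral of `h` against a fixed `L¹` weight, to which weak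
convergence applies. -/
theorem integral_mul_laplacian (h : Graphon) {u g : I → ℝ} (hu : MemLp u 2 volume)
    (hg : MemLp g 2 volume) :
    ∫ x, g x * h.laplacian u x = ∫ p : I × I, (u p.1 - u p.2) * g p.1 * h p.1 p.2 := by
  have h1 := integral_prod _ (h.integrable_mul (integrable_pairing hu hg))
  refine Eq.trans ?_ h1.symm
  refine integral_congr_ae (ae_of_all _ fun x => ?_)
  simp only [laplacian]
  rw [← integral_const_mul]
  refine integral_congr_ae (ae_of_all _ fun y => ?_)
  simp only
  ring

theorem laplacianNorm_nonneg (h : Graphon) : 0 ≤ h.laplacianNorm := ENNReal.toReal_nonneg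

theorem laplacianNorm_le_iff (h : Graphon) {β : ℝ} (hβ : 0 ≤ β) :
    h.laplacianNorm ≤ β ↔ ∀ u : I → ℝ, MemLp u 2 volume → eLpNorm u 2 volume = 1 →
      eLpNorm (h.laplacian u) 2 volume ≤ ENNReal.ofReal β := by
  rw [laplacianNorm, ← ENNReal.le_ofReal_iff_toReal_le
    (h.iSup_laplacian_le.trans_lt (by simp)).ne hβ, iSup_le_iff]
  exact ⟨fun H u h1 h2 => H ⟨u, h1, h2⟩, fun H u => H u.1 u.2.1 u.2.2⟩

theorem eLpNorm_laplacian_toReal_le (h : Graphon) {u : I → ℝ} (hu : MemLp u 2 volume)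
    (hu1 : eLpNorm u 2 volume = 1) :
    (eLpNorm (h.laplacian u) 2 volume).toReal ≤ h.laplacianNorm :=
  ENNReal.toReal_mono (h.iSup_laplacian_le.trans_lt (by simp)).ne
    (le_iSup (fun u : {u : I → ℝ // MemLp u 2 volume ∧ eLpNorm u 2 volume = 1} =>
      eLpNorm (h.laplacian u.1) 2 volume) ⟨u, hu, hu1⟩)

/-- The operator norm is lower semicontinuous with respect to the cut distance. -/
theorem laplacianNorm_le_of_tendsto {h : ℕ → Graphon} {k : Graphon}
    (hc : Tendsto (fun n => cutDist (h n) k) atTop (𝓝 0)) {b : ℕ → ℝ} {β : ℝ}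
    (hb : Tendsto b atTop (𝓝 β)) (hle : ∀ n, (h n).laplacianNorm ≤ b n) :
    k.laplacianNorm ≤ β := by
  have hβ : 0 ≤ β := ge_of_tendsto' hb fun n => (h n).laplacianNorm_nonneg.trans (hle n)
  rw [laplacianNorm_le_iff _ hβ]
  intro u hu hu1
  have hg := k.memLp_laplacian hu
  -- The test function is `ℒ_k u` itself: `‖g‖² = ⟨g, ℒ_k u⟩` is the limit of `⟨g, ℒ_{h n} u⟩`, each
  -- at most `‖g‖ b n`.
  set g := k.laplacian u
  set G := (eLpNorm g 2 volume).toReal with hG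
  have hG0 : 0 ≤ G := ENNReal.toReal_nonneg
  have h1 := tendsto_integral_mul_of_cutDist hc (integrable_pairing hu hg)
  rw [← k.integral_mul_laplacian hu hg, integral_mul_self_eq_sq_eLpNorm hg] at h1
  have h2 : G ^ 2 ≤ G * β := by
    refine le_of_tendsto_of_tendsto' h1 (hb.const_mul G) fun n => ?_
    rw [← (h n).integral_mul_laplacian hu hg]
    calc _ ≤ _ := le_abs_self _
      _ ≤ _ := abs_integral_mul_le_eLpNorm hg ((h n).memLp_laplacian hu)
      _ ≤ G * b n := by
        gcongr
        exact ((h n).eLpNorm_laplacian_toReal_le hu hu1).trans (hle n)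
  rw [ENNReal.le_ofReal_iff_toReal_le hg.2.ne hβ]
  rcases hG0.eq_or_lt with h0 | h0
  · rw [← hG, ← h0]; exact hβ
  · exact le_of_mul_le_mul_left (by rwa [sq] at h2) h0

/-- Relabeling conjugates the operator by an `L²` isometry, so it preserves the norm. -/
theorem laplacian_relabel (h : Graphon) (φ : Relabeling) (u : I → ℝ) :
    (h.relabel φ).laplacian u = h.laplacian (u ∘ φ.1.symm) ∘ φ.1 := by
  funext x
  have h1 := φ.2.integral_comp φ.1.measurableEmbedding
    (fun y => h (φ.1 x) y * (u x - u (φ.1.symm y)))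
  simp only [MeasurableEquiv.symm_apply_apply] at h1
  simpa [laplacian, relabel] using h1

theorem laplacianNorm_relabel_le (h : Graphon) (φ : Relabeling) :
    (h.relabel φ).laplacianNorm ≤ h.laplacianNorm := by
  rw [laplacianNorm_le_iff _ h.laplacianNorm_nonneg]
  intro u hu hu1
  have hv : MemLp (u ∘ φ.1.symm) 2 volume := hu.comp_measurePreserving (φ.2.symm φ.1)
  have hv1 : eLpNorm (u ∘ φ.1.symm) 2 volume = 1 := by
    rw [eLpNorm_comp_measurePreserving hu.1 (φ.2.symm φ.1), hu1]
  rw [laplacian_relabel, eLpNorm_comp_measurePreserving (h.memLp_laplacian hv).1 φ.2]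
  exact (h.laplacianNorm_le_iff h.laplacianNorm_nonneg).1 le_rfl _ hv hv1

theorem laplacianNorm_relabel (h : Graphon) (φ : Relabeling) :
    (h.relabel φ).laplacianNorm = h.laplacianNorm := by
  refine le_antisymm (h.laplacianNorm_relabel_le φ) ?_
  have := (h.relabel φ).laplacianNorm_relabel_le φ.symm
  rwa [relabel_relabel_symm] at this

theorem laplacian_mix (h k : Graphon) {t : ℝ} (ht : t ∈ Icc (0 : ℝ) 1) {u : I → ℝ}
    (hu : Integrable u) :
    (mix h k t ht).laplacian u = (1 - t) • h.laplacian u + t • k.laplacian u := by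
  funext x
  have key : ∀ l : Graphon, Integrable fun y => l x y * (u x - u y) := fun l =>
    l.integrable_section_mul x ((integrable_const _).sub hu)
  simp only [Pi.add_apply, Pi.smul_apply, smul_eq_mul, laplacian]
  rw [← integral_const_mul, ← integral_const_mul, ← integral_add ((key h).const_mul _)
    ((key k).const_mul _)]
  refine integral_congr_ae (ae_of_all _ fun y => ?_)
  simp only [mix]
  ring

/-- The Laplacian is linear in the graphon, so this is the triangle inequality; it makes the
constraint sets convex. -/
theorem laplacianNorm_mix_le (h k : Graphon) {t : ℝ} (ht : t ∈ Icc (0 : ℝ) 1) :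
    (mix h k t ht).laplacianNorm ≤ (1 - t) * h.laplacianNorm + t * k.laplacianNorm := by
  have h0 : 0 ≤ 1 - t := sub_nonneg.2 ht.2
  rw [laplacianNorm_le_iff _ (add_nonneg (mul_nonneg h0 h.laplacianNorm_nonneg)
    (mul_nonneg ht.1 k.laplacianNorm_nonneg))]
  intro u hu hu1
  have hh := h.memLp_laplacian hu
  have hk := k.memLp_laplacian hu
  rw [laplacian_mix h k ht (hu.integrable (by norm_num)), ENNReal.ofReal_add
    (mul_nonneg h0 h.laplacianNorm_nonneg) (mul_nonneg ht.1 k.laplacianNorm_nonneg),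
    ENNReal.ofReal_mul h0, ENNReal.ofReal_mul ht.1]
  refine (eLpNorm_add_le (hh.1.const_smul _) (hk.1.const_smul _) (by norm_num)).trans ?_
  rw [eLpNorm_const_smul, eLpNorm_const_smul, Real.enorm_of_nonneg h0, Real.enorm_of_nonneg ht.1]
  gcongr
  · exact (h.laplacianNorm_le_iff h.laplacianNorm_nonneg).1 le_rfl _ hu hu1
  · exact (k.laplacianNorm_le_iff k.laplacianNorm_nonneg).1 le_rfl _ hu hu1

theorem laplacianNorm_zero : (0 : Graphon).laplacianNorm = 0 := by
  refine le_antisymm ((laplacianNorm_le_iff _ le_rfl).2 fun u _ _ => ?_) (laplacianNorm_nonneg _)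
  have h1 : (0 : Graphon).laplacian u = 0 := by
    funext x
    simp [laplacian, zero_apply]
  simp [h1]

/-- The cut distance vanishes, so lower semicontinuity along constant sequences applies both ways.
-/
theorem laplacianNorm_congr_ae {h k : Graphon} (hk : ∀ᵐ p : I × I, h p.1 p.2 = k p.1 p.2) :
    h.laplacianNorm = k.laplacianNorm := by
  have h1 : cutDist h k = 0 := by
    refine le_antisymm ((cutDist_le_sqrt_sqDist h k).trans_eq ?_) (cutDist_nonneg _ _)
    have h2 : sqDist h k = 0 := by
      refine integral_eq_zero_of_ae ?_
      filter_upwards [hk] with p hp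
      simp [hp]
    rw [h2, Real.sqrt_zero]
  refine le_antisymm ?_ ?_
  · refine laplacianNorm_le_of_tendsto (h := fun _ => k) (k := h) (b := fun _ => k.laplacianNorm)
      ?_ tendsto_const_nhds fun _ => le_rfl
    simp [cutDist_comm k h, h1]
  · refine laplacianNorm_le_of_tendsto (h := fun _ => h) (k := k) (b := fun _ => h.laplacianNorm)
      ?_ tendsto_const_nhds fun _ => le_rfl
    simp [h1]

theorem laplacian_ae_eq_zero {h : Graphon} (h0 : h.laplacianNorm = 0) {u : I → ℝ}
    (hu : MemLp u 2 volume) (hu1 : eLpNorm u 2 volume = 1) : h.laplacian u =ᵐ[volume] 0 := by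
  have h1 := (h.laplacianNorm_le_iff le_rfl).1 h0.le u hu hu1
  rw [ENNReal.ofReal_zero, nonpos_iff_eq_zero] at h1
  exact (eLpNorm_eq_zero_iff (h.memLp_laplacian hu).1 (by norm_num)).1 h1

theorem ae_fst_ne_snd : ∀ᵐ p : I × I, p.1 ≠ p.2 := by
  have hm : MeasurableSet {p : I × I | p.1 ≠ p.2} :=
    (measurableSet_eq_fun measurable_fst measurable_snd).compl
  refine (Measure.ae_prod_mem_iff_ae_ae_mem (μ := (volume : Measure I)) (ν := volume) hm).2
    (ae_of_all _ fun x => ?_)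
  have h1 : ∀ᵐ y : I, y ≠ x := by
    simp [ae_iff]
  exact h1.mono fun y hy => hy.symm

/-- Only the zero graphon has a vanishing Laplacian: test with the identity function. -/
theorem ae_eq_zero_of_laplacianNorm_eq_zero {h : Graphon} (h0 : h.laplacianNorm = 0) :
    ∀ᵐ p : I × I, h p.1 p.2 = 0 := by
  have hv : MemLp (fun x : I => (x : ℝ)) 2 volume :=
    MemLp.of_bound measurable_subtype_coe.aestronglyMeasurable 1 (ae_of_all _ fun x => by
      rw [Real.norm_eq_abs, abs_of_nonneg x.2.1]; exact x.2.2)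
  have hv0 : eLpNorm (fun x : I => (x : ℝ)) 2 volume ≠ 0 := by
    rw [Ne, eLpNorm_eq_zero_iff hv.1 (by norm_num)]
    intro hz
    have h1 : ∀ᵐ x : I, x ≠ 0 := by simp [ae_iff]
    obtain ⟨x, hx, hx'⟩ := (hz.and h1).exists
    exact hx' (Subtype.ext hx)
  set c := (eLpNorm (fun x : I => (x : ℝ)) 2 volume).toReal with hcdef
  have hc : 0 < c := ENNReal.toReal_pos hv0 hv.2.ne
  set u : I → ℝ := c⁻¹ • (fun x : I => (x : ℝ)) with hudef
  have hu : MemLp u 2 volume := hv.const_smul _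
  have hu1 : eLpNorm u 2 volume = 1 := by
    rw [hudef, eLpNorm_const_smul, Real.enorm_of_nonneg (by positivity), ENNReal.ofReal_inv_of_pos hc,
      hcdef, ENNReal.ofReal_toReal hv.2.ne]
    exact ENNReal.inv_mul_cancel hv0 hv.2.ne
  have h2 : ∫ p : I × I, (u p.1 - u p.2) * u p.1 * h p.1 p.2 = 0 := by
    rw [← h.integral_mul_laplacian hu hu]
    refine integral_eq_zero_of_ae ?_
    filter_upwards [laplacian_ae_eq_zero h0 hu hu1] with x hx
    simp [hx]
  have hint := h.integrable_mul (integrable_pairing hu hu)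
  -- Swapping the variables and adding gives `∫ (u x - u y)² h = 0` by symmetry of `h`. As `u` is
  -- injective, `h` vanishes a.e. off the diagonal, a null set.
  have h3 : ∫ p : I × I, (u p.2 - u p.1) * u p.2 * h p.2 p.1 = 0 := by
    rw [← h2]
    exact integral_prod_swap (μ := (volume : Measure I)) (ν := volume)
      (fun p : I × I => (u p.1 - u p.2) * u p.1 * h p.1 p.2)
  have hint' : Integrable (fun p : I × I => (u p.2 - u p.1) * u p.2 * h p.2 p.1) := hint.swap
  have heq : (fun p : I × I => (u p.1 - u p.2) ^ 2 * h p.1 p.2)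
      = (fun p : I × I => (u p.1 - u p.2) * u p.1 * h p.1 p.2)
        + fun p => (u p.2 - u p.1) * u p.2 * h p.2 p.1 := by
    funext p
    simp only [Pi.add_apply]
    rw [h.symm' p.2 p.1]
    ring
  have h4 : ∫ p : I × I, (u p.1 - u p.2) ^ 2 * h p.1 p.2 = 0 := by
    rw [heq, integral_add' hint hint', h2, h3, add_zero]
  have h5 := (integral_eq_zero_iff_of_nonneg
    (fun p : I × I => mul_nonneg (sq_nonneg (u p.1 - u p.2)) (h.nonneg' p.1 p.2))
    (heq ▸ hint.add hint')).1 h4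
  filter_upwards [h5, ae_fst_ne_snd] with p hp hne
  rcases mul_eq_zero.1 hp with h6 | h6
  · exfalso
    have h7 : u p.1 = u p.2 := sub_eq_zero.1 (pow_eq_zero_iff two_ne_zero |>.1 h6)
    simp only [hudef, Pi.smul_apply, smul_eq_mul] at h7
    exact hne (Subtype.ext (mul_left_cancel₀ (inv_ne_zero hc.ne') h7))
  · exact h6

/-! ### Independence of the representative -/

theorem cutMetric_relabel_right (h k : Graphon) (φ : Relabeling) :
    cutMetric h (k.relabel φ) = cutMetric h k := by
  have key : ∀ (l : Graphon) (ψ : Relabeling), cutMetric h (l.relabel ψ) ≤ cutMetric h l :=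
    fun l ψ => le_ciInf fun χ => by
      refine (cutMetric_le h (l.relabel ψ) (χ.trans ψ.symm)).trans_eq ?_
      rw [relabel_trans, relabel_relabel_symm]
  refine le_antisymm (key k φ) ?_
  have h1 := key (k.relabel φ) φ.symm
  rwa [relabel_relabel_symm] at h1

/-- The infimum in `δ_□` need not be attained, so equivalent graphons are linked only by a sequence
of relabelings; semicontinuity has to do the rest. -/
theorem exists_tendsto_cutDist_relabel {h k : Graphon} (h0 : cutMetric h k = 0) :
    ∃ φ : ℕ → Relabeling, Tendsto (fun n => cutDist (k.relabel (φ n)) h) atTop (𝓝 0) := by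
  have h1 : ∀ n : ℕ, ∃ φ : Relabeling, cutDist (k.relabel φ) h < 1 / ((n : ℝ) + 1) := fun n => by
    have h2 : cutMetric h k < 1 / ((n : ℝ) + 1) := by rw [h0]; positivity
    obtain ⟨φ, hφ⟩ := exists_lt_of_ciInf_lt h2
    exact ⟨φ, by rwa [cutDist_comm]⟩
  choose φ hφ using h1
  exact ⟨φ, squeeze_zero (fun _ => cutDist_nonneg _ _) (fun n => (hφ n).le)
    tendsto_one_div_add_atTop_nhds_zero_nat⟩

theorem laplacianNorm_le_of_cutMetric_eq_zero {h k : Graphon} (h0 : cutMetric h k = 0) :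
    h.laplacianNorm ≤ k.laplacianNorm := by
  obtain ⟨φ, hφ⟩ := exists_tendsto_cutDist_relabel h0
  exact laplacianNorm_le_of_tendsto hφ tendsto_const_nhds fun n => (k.laplacianNorm_relabel _).le

theorem integral_comp_relabel (h : Graphon) (φ : Relabeling) (F : ℝ → ℝ) :
    ∫ p : I × I, F (h.relabel φ p.1 p.2) = ∫ p : I × I, F (h p.1 p.2) := by
  have hmp : MeasurePreserving (φ.1.prodCongr φ.1) (volume : Measure (I × I)) volume :=
    φ.2.prod φ.2
  exact hmp.integral_comp (φ.1.prodCongr φ.1).measurableEmbedding (fun p : I × I => F (h p.1 p.2))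

theorem mul_log_div_le {a b t : ℝ} (ha : 0 ≤ a) (ht : t < 1) (hb : (1 - t) * a ≤ b) :
    a * Real.log (a / b) ≤ a * -Real.log (1 - t) := by
  rcases ha.eq_or_lt with rfl | ha'
  · simp
  · have h1 : 0 < (1 - t) * a := mul_pos (sub_pos.2 ht) ha'
    refine mul_le_mul_of_nonneg_left ?_ ha
    rw [← Real.log_inv]
    refine Real.log_le_log (div_pos ha' (h1.trans_le hb)) ?_
    rw [inv_eq_one_div, div_le_div_iff₀ (h1.trans_le hb) (sub_pos.2 ht)]
    linarith

/-- Mixing with the constant graphon `1 / 2`. -/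
def soften (h : Graphon) (t : ℝ) (ht : t ∈ Icc (0 : ℝ) 1) : Graphon :=
  mix h (const (1 / 2) half_mem_Icc) t ht

theorem soften_apply (h : Graphon) {t : ℝ} (ht : t ∈ Icc (0 : ℝ) 1) (x y : I) :
    h.soften t ht x y = (1 - t) * h x y + t * (1 / 2) := rfl

theorem soften_mem_Icc (h : Graphon) {t : ℝ} (ht : t ∈ Icc (0 : ℝ) 1) (x y : I) :
    h.soften t ht x y ∈ Icc (t / 2) (1 - t / 2) := by
  rw [soften_apply]
  have h1 := h.mem_Icc x y
  constructor <;> nlinarith [h1.1, h1.2, ht.1, ht.2]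

theorem basicAssumption_of_mem_Icc {g : Graphon} {ε : ℝ} (hε : 0 < ε)
    (hg : ∀ x y, g x y ∈ Icc ε (1 - ε)) : g.BasicAssumption := by
  have key : ∀ s : ℝ, s ∈ Icc ε (1 - ε) → ‖Real.log s‖ ≤ -Real.log ε := fun s hs => by
    have h1 : Real.log s ≤ 0 := Real.log_nonpos (hε.le.trans hs.1) (by linarith [hs.2])
    rw [Real.norm_eq_abs, abs_of_nonpos h1]
    exact neg_le_neg (Real.log_le_log hε hs.1)
  refine ⟨ae_of_all _ fun p => ⟨hε.trans_le (hg _ _).1, by linarith [(hg p.1 p.2).2]⟩,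
    Integrable.of_bound (C := -Real.log ε) (Real.measurable_log.comp
      g.measurable).aestronglyMeasurable (ae_of_all _ fun p => key _ (hg _ _)),
    Integrable.of_bound (C := -Real.log ε) (Real.measurable_log.comp
      (g.measurable.const_sub 1)).aestronglyMeasurable (ae_of_all _ fun p => key _ ?_)⟩
  have h1 := hg p.1 p.2
  exact ⟨by linarith [h1.2], by linarith [h1.1]⟩

/-- Both `h` and `1 - h` are at most `1 / (1 - t)` times their softened versions, which bounds both
logarithms. -/
theorem entropy_soften_le (h : Graphon) {t : ℝ} (ht : t ∈ Ioo (0 : ℝ) 1) :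
    (h.soften t (Ioo_subset_Icc_self ht)).entropy h ≤ -Real.log (1 - t) := by
  have hg := basicAssumption_of_mem_Icc (half_pos ht.1) (h.soften_mem_Icc (Ioo_subset_Icc_self ht))
  have h1 : (h.soften t (Ioo_subset_Icc_self ht)).entropy h
      ≤ ∫ _ : I × I, -Real.log (1 - t) := by
    refine integral_mono (integrable_bernoulliEntropy hg h) (integrable_const _) fun p => ?_
    have hp := h.mem_Icc p.1 p.2
    have h2 := mul_log_div_le (b := h.soften t (Ioo_subset_Icc_self ht) p.1 p.2) hp.1 ht.2
      (by rw [soften_apply]; linarith [ht.1])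
    have h3 := mul_log_div_le (a := 1 - h p.1 p.2)
      (b := 1 - h.soften t (Ioo_subset_Icc_self ht) p.1 p.2)
      (by linarith [hp.2]) ht.2 (by rw [soften_apply]; linarith [ht.1])
    simp only [bernoulliEntropy]
    linarith
  simpa using h1

/-- The integral of the binary entropy is upper semicontinuous under the cut distance. -/
theorem le_integral_binEntropy_of_tendsto {h : ℕ → Graphon} {k : Graphon}
    (hc : Tendsto (fun n => cutDist (h n) k) atTop (𝓝 0)) {c : ℝ}
    (hle : ∀ n, c ≤ ∫ p : I × I, Real.binEntropy (h n p.1 p.2)) :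
    c ≤ ∫ p : I × I, Real.binEntropy (k p.1 p.2) := by
  refine le_of_forall_pos_le_add fun ε hε => ?_
  -- This `t` makes `-log (1 - t) = ε`, so the softened `k`, called `g` below, satisfies `I_g(k) ≤
  -- ε`.
  have ht : 1 - Real.exp (-ε) ∈ Ioo (0 : ℝ) 1 :=
    ⟨by simpa using hε, by linarith [Real.exp_pos (-ε)]⟩
  have hg := basicAssumption_of_mem_Icc (half_pos ht.1) (k.soften_mem_Icc (Ioo_subset_Icc_self ht))
  have h1 := k.entropy_soften_le ht
  rw [sub_sub_cancel, Real.log_exp, neg_neg] at h1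
  set g := k.soften _ (Ioo_subset_Icc_self ht)
  have h2 := (tendsto_integral_mul_of_cutDist hc
    (hg.integrable_log_one_sub.sub hg.integrable_log)).sub_const
    (∫ p : I × I, Real.log (1 - g p.1 p.2))
  have h3 := entropy_eq hg k
  -- Gibbs' inequality: `I_g(h n) ≥ 0` bounds `∫ binEntropy (h n)` by an expression affine in `h n`
  -- with `L¹` weight, which passes to the limit. At `k` this bound exceeds the true value by
  -- `I_g(k) ≤ ε`.
  have h4 := ge_of_tendsto' h2 (b := c) fun n => by
    have h5 := entropy_eq hg (h n)
    have h6 := entropy_nonneg hg (h n)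
    have h7 := hle n
    simp only [Pi.sub_apply]
    linarith
  simp only [Pi.sub_apply] at h4
  linarith

theorem integral_binEntropy_eq_of_cutMetric_eq_zero {h k : Graphon} (h0 : cutMetric h k = 0) :
    ∫ p : I × I, Real.binEntropy (h p.1 p.2) = ∫ p : I × I, Real.binEntropy (k p.1 p.2) := by
  have key : ∀ {h k : Graphon}, cutMetric h k = 0 →
      ∫ p : I × I, Real.binEntropy (k p.1 p.2) ≤ ∫ p : I × I, Real.binEntropy (h p.1 p.2) := by
    intro h k h0
    obtain ⟨φ, hφ⟩ := exists_tendsto_cutDist_relabel h0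
    exact le_integral_binEntropy_of_tendsto hφ fun n =>
      (k.integral_comp_relabel (φ n) Real.binEntropy).ge
  exact le_antisymm (key (le_antisymm ((cutMetric_comm_le k h).trans_eq h0) (cutMetric_nonneg _ _)))
    (key h0)

theorem bddBelow_range_entropy {r : Graphon} (hr : r.BasicAssumption) (h : Graphon) :
    BddBelow (range fun φ : Relabeling => r.entropy (h.relabel φ)) :=
  ⟨0, by rintro _ ⟨φ, rfl⟩; exact entropy_nonneg hr _⟩

theorem rate_le_entropy_relabel {r : Graphon} (hr : r.BasicAssumption) (h : Graphon)
    (φ : Relabeling) : r.rate h ≤ r.entropy (h.relabel φ) :=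
  ciInf_le (bddBelow_range_entropy hr h) φ

theorem rate_le_entropy {r : Graphon} (hr : r.BasicAssumption) (h : Graphon) :
    r.rate h ≤ r.entropy h := rate_le_entropy_relabel hr h Relabeling.refl

theorem rate_nonneg {r : Graphon} (hr : r.BasicAssumption) (h : Graphon) : 0 ≤ r.rate h :=
  le_ciInf fun _ => entropy_nonneg hr _

/-- Each `k^ψ` is a cut limit of relabelings of `h`. The linear part of `I_r` converges along them
and the binary entropy part is the same throughout, so `I_r` itself converges to `I_r(k^ψ)`. -/
theorem rate_le_of_cutMetric_eq_zero {r : Graphon} (hr : r.BasicAssumption) {h k : Graphon}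
    (h0 : cutMetric h k = 0) : r.rate h ≤ r.rate k := by
  refine le_ciInf fun ψ => ?_
  have h1 : cutMetric (k.relabel ψ) h = 0 := by
    refine le_antisymm ((cutMetric_comm_le _ _).trans_eq ?_) (cutMetric_nonneg _ _)
    rw [cutMetric_relabel_right, h0]
  obtain ⟨φ, hφ⟩ := exists_tendsto_cutDist_relabel h1
  have h2 := ((tendsto_integral_mul_of_cutDist hφ
    (hr.integrable_log_one_sub.sub hr.integrable_log)).sub_const
    (∫ p : I × I, Real.binEntropy (k.relabel ψ p.1 p.2))).sub_const
    (∫ p : I × I, Real.log (1 - r p.1 p.2))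
  simp only [Pi.sub_apply] at h2
  rw [← entropy_eq hr] at h2
  refine ge_of_tendsto' h2 fun n => (rate_le_entropy_relabel hr h (φ n)).trans_eq ?_
  rw [entropy_eq hr, h.integral_comp_relabel (φ n) Real.binEntropy,
    integral_binEntropy_eq_of_cutMetric_eq_zero h1]

end Graphon

namespace QuotientGraphon

theorem cutMetric_rep_mk (h : Graphon) : Graphon.cutMetric (mk h).rep h = 0 :=
  (mk_eq_mk_iff _ _).1 (mk_rep _)

theorem cutMetric_mk_rep (h : Graphon) : Graphon.cutMetric h (mk h).rep = 0 :=
  (mk_eq_mk_iff _ _).1 (mk_rep _).symm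

theorem laplacianNorm_mk (h : Graphon) : (mk h).laplacianNorm = h.laplacianNorm :=
  le_antisymm (Graphon.laplacianNorm_le_of_cutMetric_eq_zero (cutMetric_rep_mk h))
    (Graphon.laplacianNorm_le_of_cutMetric_eq_zero (cutMetric_mk_rep h))

theorem J_mk {r : Graphon} (hr : r.BasicAssumption) (h : Graphon) : (mk h).J r = r.rate h :=
  le_antisymm (Graphon.rate_le_of_cutMetric_eq_zero hr (cutMetric_rep_mk h))
    (Graphon.rate_le_of_cutMetric_eq_zero hr (cutMetric_mk_rep h))

end QuotientGraphon

/-! ### Existence of minimisers and properties of the value function -/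

namespace Graphon

theorem memLp (h : Graphon) : MemLp (fun p : I × I => h p.1 p.2) 2 volume :=
  MemLp.of_bound h.measurable.aestronglyMeasurable 1 (ae_of_all _ fun p => by
    rw [Real.norm_eq_abs, abs_of_nonneg (h.nonneg' _ _)]; exact h.le_one' _ _)

theorem dist_toLp (h k : Graphon) :
    dist (h.memLp.toLp _) (k.memLp.toLp _) = √(sqDist h k) := by
  have hd : MemLp (fun p : I × I => h p.1 p.2 - k p.1 p.2) 2 volume := h.memLp.sub k.memLp
  have h1 : sqDist h k = (eLpNorm (fun p : I × I => h p.1 p.2 - k p.1 p.2) 2 volume).toReal ^ 2 := by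
    rw [← integral_mul_self_eq_sq_eLpNorm hd, sqDist]
    simp only [sq]
  rw [h1, Real.sqrt_sq ENNReal.toReal_nonneg, dist_eq_norm, ← MemLp.toLp_sub, Lp.norm_toLp]
  rfl

/-- The pointwise upper limit of a sequence of graphons. -/
def limsupGraphon (h : ℕ → Graphon) : Graphon where
  toFun x y := limsup (fun n => h n x y) atTop
  measurable' := Measurable.limsup fun n => (h n).measurable'
  symm' x y := by simp only [(h _).symm' x y]
  nonneg' x y := le_limsup_of_frequently_le (Frequently.of_forall fun n => (h n).nonneg' x y)
    (isBoundedUnder_of ⟨1, fun n => (h n).le_one' x y⟩)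
  le_one' x y := limsup_le_of_le (isCoboundedUnder_le_of_le atTop fun n => (h n).nonneg' x y)
    (Eventually.of_forall fun n => (h n).le_one' x y)

/-- An `L²`-Cauchy sequence of graphons has an almost everywhere convergent subsequence. -/
theorem exists_subseq_tendsto_ae {h : ℕ → Graphon} {B : ℕ → ℝ} (hB : Tendsto B atTop (𝓝 0))
    (hle : ∀ n m N, N ≤ n → N ≤ m → sqDist (h n) (h m) ≤ B N) :
    ∃ (g : Graphon) (ns : ℕ → ℕ), StrictMono ns ∧
      ∀ᵐ p : I × I, Tendsto (fun i => h (ns i) p.1 p.2) atTop (𝓝 (g p.1 p.2)) := by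
  have hcau : CauchySeq fun n => (h n).memLp.toLp _ := by
    refine cauchySeq_of_le_tendsto_0 (fun N => √(B N)) (fun n m N hn hm => ?_) ?_
    · rw [dist_toLp]
      exact Real.sqrt_le_sqrt (hle n m N hn hm)
    · simpa [Function.comp_def] using (Real.continuous_sqrt.tendsto 0).comp hB
  obtain ⟨f, hf⟩ := cauchySeq_tendsto_of_complete hcau
  obtain ⟨ns, hns, hae⟩ := (tendstoInMeasure_of_tendsto_Lp hf).exists_seq_tendsto_ae
  -- The pointwise limsup is symmetric and `[0,1]`-valued everywhere, unlike the `L²` limit `f`, and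
  -- equals `f` a.e.
  refine ⟨limsupGraphon fun i => h (ns i), ns, hns, ?_⟩
  filter_upwards [hae, ae_all_iff.2 fun n => (h n).memLp.coeFn_toLp] with p hp hp'
  simp only [hp'] at hp
  have h1 : limsupGraphon (fun i => h (ns i)) p.1 p.2 = f p := hp.limsup_eq
  rwa [h1]

theorem tendsto_cutDist_of_ae {h : ℕ → Graphon} {g : Graphon}
    (hg : ∀ᵐ p : I × I, Tendsto (fun i => h i p.1 p.2) atTop (𝓝 (g p.1 p.2))) :
    Tendsto (fun i => cutDist (h i) g) atTop (𝓝 0) := by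
  have h1 : Tendsto (fun i => sqDist (h i) g) atTop (𝓝 (∫ _ : I × I, (0 : ℝ))) := by
    refine tendsto_integral_of_dominated_convergence (fun _ => 1)
      (fun n => (integrable_sq_sub (h n) g).aestronglyMeasurable) (integrable_const _)
      (fun n => ae_of_all _ fun p => ?_) (hg.mono fun p hp => ?_)
    · rw [Real.norm_eq_abs, abs_pow]
      exact pow_le_one₀ (abs_nonneg _) (abs_sub_le_one (h n) g _ _)
    · simpa using (hp.sub_const (g p.1 p.2)).pow 2
  rw [integral_zero] at h1
  refine squeeze_zero (fun _ => cutDist_nonneg _ _) (fun i => cutDist_le_sqrt_sqDist (h i) g) ?_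
  simpa [Function.comp_def] using (Real.continuous_sqrt.tendsto 0).comp h1

/-- The infimum of `I_r` over all graphons `h` with `‖ℒ_h‖ ≤ β`. -/
def minEntropy (r : Graphon) (β : ℝ) : ℝ := sInf (r.entropy '' {h : Graphon | h.laplacianNorm ≤ β})

variable {r : Graphon}

theorem minEntropy_le (hr : r.BasicAssumption) {h : Graphon} {β : ℝ} (hh : h.laplacianNorm ≤ β) :
    r.minEntropy β ≤ r.entropy h :=
  csInf_le ⟨0, by rintro _ ⟨k, -, rfl⟩; exact entropy_nonneg hr k⟩ (mem_image_of_mem _ hh)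

theorem image_entropy_nonempty (r : Graphon) {β : ℝ} (hβ : 0 ≤ β) :
    (r.entropy '' {h : Graphon | h.laplacianNorm ≤ β}).Nonempty :=
  ⟨_, mem_image_of_mem _ (show (0 : Graphon).laplacianNorm ≤ β by rwa [laplacianNorm_zero])⟩

theorem minEntropy_anti (hr : r.BasicAssumption) {β β' : ℝ} (hβ : 0 ≤ β) (hle : β ≤ β') :
    r.minEntropy β' ≤ r.minEntropy β :=
  le_csInf (image_entropy_nonempty r hβ) (by
    rintro _ ⟨h, hh, rfl⟩
    exact minEntropy_le hr (le_trans hh hle))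

/-- Take near-minimisers `h n` for the bounds `b n`. For `n, m ≥ N` the midpoint of `h n` and `h m`
obeys the bound `b N`, so its entropy is at least `minEntropy (b N)`, while both ends have entropy
at most `c + 1 / (N + 1)`. Uniform convexity makes the sequence `L²`-Cauchy. -/
theorem exists_entropy_le_of_tendsto (hr : r.BasicAssumption) {b : ℕ → ℝ} {β c : ℝ} (hβ : 0 ≤ β)
    (hanti : Antitone b) (hb : Tendsto b atTop (𝓝 β)) (hc : ∀ n, r.minEntropy (b n) ≤ c)
    (hlim : Tendsto (fun n => r.minEntropy (b n)) atTop (𝓝 c)) :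
    ∃ g : Graphon, g.laplacianNorm ≤ β ∧ r.entropy g ≤ c := by
  have hb0 : ∀ n, 0 ≤ b n := fun n => hβ.trans (hanti.le_of_tendsto hb n)
  have hex : ∀ n : ℕ, ∃ h : Graphon, h.laplacianNorm ≤ b n ∧
      r.entropy h < r.minEntropy (b n) + 1 / ((n : ℝ) + 1) := fun n => by
    obtain ⟨_, ⟨h, hh, rfl⟩, hlt⟩ := exists_lt_of_csInf_lt (image_entropy_nonempty r (hb0 n))
      (lt_add_of_pos_right (r.minEntropy (b n)) (by positivity : (0 : ℝ) < 1 / ((n : ℝ) + 1)))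
    exact ⟨h, hh, hlt⟩
  choose h hh hI using hex
  have hI' : ∀ n N : ℕ, N ≤ n → r.entropy (h n) ≤ c + 1 / ((N : ℝ) + 1) := fun n N hn =>
    (hI n).le.trans (add_le_add (hc n) (one_div_le_one_div_of_le (by positivity) (by
      gcongr)))
  -- The factor `8` inverts the `sqDist / 8` of `entropy_midpoint`.
  have hB : Tendsto (fun N : ℕ => 8 * (c + 1 / ((N : ℝ) + 1) - r.minEntropy (b N))) atTop (𝓝 0) := by
    have h1 := ((tendsto_one_div_add_atTop_nhds_zero_nat (𝕜 := ℝ)).const_add c).sub hlim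
    simpa using h1.const_mul 8
  obtain ⟨g, ns, hns, hg⟩ := exists_subseq_tendsto_ae (h := h) hB fun n m N hn hm => by
    have h1 := entropy_midpoint hr (h n) (h m)
    have h2 : r.minEntropy (b N) ≤ r.entropy (mix (h n) (h m) (1 / 2) half_mem_Icc) := by
      refine minEntropy_le hr ((laplacianNorm_mix_le _ _ _).trans ?_)
      have h3 := (hh n).trans (hanti hn)
      have h4 := (hh m).trans (hanti hm)
      linarith
    have h3 := hI' n N hn
    have h4 := hI' m N hm
    linarith
  refine ⟨g, laplacianNorm_le_of_tendsto (tendsto_cutDist_of_ae hg)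
    (hb.comp hns.tendsto_atTop) fun i => hh _, ?_⟩
  have h1 : Tendsto (fun i => c + 1 / ((ns i : ℝ) + 1)) atTop (𝓝 (c + 0)) :=
    ((tendsto_one_div_add_atTop_nhds_zero_nat (𝕜 := ℝ)).comp hns.tendsto_atTop).const_add c
  rw [add_zero] at h1
  exact le_of_tendsto_of_tendsto' (tendsto_entropy_of_ae hr hg) h1 fun i => hI' _ _ le_rfl

theorem exists_entropy_eq_minEntropy (hr : r.BasicAssumption) {β : ℝ} (hβ : 0 ≤ β) :
    ∃ g : Graphon, g.laplacianNorm ≤ β ∧ r.entropy g = r.minEntropy β := by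
  obtain ⟨g, hg, hle⟩ := exists_entropy_le_of_tendsto hr hβ (b := fun _ => β) antitone_const
    tendsto_const_nhds (fun _ => le_rfl) tendsto_const_nhds
  exact ⟨g, hg, le_antisymm hle (minEntropy_le hr hg)⟩

theorem minEntropy_nonneg (hr : r.BasicAssumption) (β : ℝ) : 0 ≤ r.minEntropy β :=
  Real.sInf_nonneg (by rintro _ ⟨k, -, rfl⟩; exact entropy_nonneg hr k)

theorem minEntropy_zero (hr : r.BasicAssumption) : r.minEntropy 0 = r.zeroConst := by
  obtain ⟨g, hg, hI⟩ := exists_entropy_eq_minEntropy hr le_rfl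
  have h0 := ae_eq_zero_of_laplacianNorm_eq_zero (le_antisymm hg g.laplacianNorm_nonneg)
  rw [← hI, ← entropy_zero]
  exact entropy_congr_ae r h0

theorem minEntropy_normConst (hr : r.BasicAssumption) : r.minEntropy r.normConst = 0 :=
  le_antisymm ((minEntropy_le hr le_rfl).trans_eq (entropy_self hr)) (minEntropy_nonneg hr _)

theorem minEntropy_convex (hr : r.BasicAssumption) {a b t : ℝ} (ha : 0 ≤ a) (hb : 0 ≤ b)
    (ht : t ∈ Icc (0 : ℝ) 1) :
    r.minEntropy ((1 - t) * a + t * b) ≤ (1 - t) * r.minEntropy a + t * r.minEntropy b := by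
  obtain ⟨g, hg, hgI⟩ := exists_entropy_eq_minEntropy hr ha
  obtain ⟨k, hk, hkI⟩ := exists_entropy_eq_minEntropy hr hb
  rw [← hgI, ← hkI]
  refine (minEntropy_le hr ((laplacianNorm_mix_le g k ht).trans ?_)).trans (entropy_mix_le hr g k ht)
  have := sub_nonneg.2 ht.2
  have := ht.1
  gcongr

theorem ae_eq_of_sqDist_eq_zero {h k : Graphon} (h0 : sqDist h k = 0) :
    ∀ᵐ p : I × I, h p.1 p.2 = k p.1 p.2 := by
  have h1 := (integral_eq_zero_iff_of_nonneg (fun p : I × I => sq_nonneg (h p.1 p.2 - k p.1 p.2))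
    (integrable_sq_sub h k)).1 h0
  filter_upwards [h1] with p hp
  exact sub_eq_zero.1 (pow_eq_zero_iff two_ne_zero |>.1 hp)

/-- A minimiser with zero entropy equals `r` a.e. by the Pinsker-type bound, so its norm would be
`C_r`. -/
theorem minEntropy_pos (hr : r.BasicAssumption) {β : ℝ} (hβ : 0 ≤ β) (hlt : β < r.normConst) :
    0 < r.minEntropy β := by
  refine (minEntropy_nonneg hr β).lt_of_ne fun h0 => ?_
  obtain ⟨g, hg, hI⟩ := exists_entropy_eq_minEntropy hr hβ
  have h1 := sqDist_le_entropy hr g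
  have h2 := sqDist_nonneg g r
  have h3 := laplacianNorm_congr_ae (ae_eq_of_sqDist_eq_zero (h := g) (k := r) (by linarith))
  rw [normConst, ← h3] at hlt
  exact hlt.not_ge hg

theorem strictAntiOn_minEntropy (hr : r.BasicAssumption) :
    StrictAntiOn r.minEntropy (Icc 0 r.normConst) := by
  intro a ha b hb hab
  have hpos : 0 < r.normConst - a := by linarith [hb.2]
  -- The weight that writes `b` as a mixture of `a` and `C_r`; convexity then gives the value at `b`
  -- as at most `1 - t` times the positive value at `a`.
  set t := (b - a) / (r.normConst - a) with ht
  have ht0 : 0 < t := div_pos (sub_pos.2 hab) hpos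
  have ht1 : t ≤ 1 := (div_le_one hpos).2 (by linarith [hb.2])
  have h1 := minEntropy_convex hr ha.1 (ha.1.trans ha.2) (t := t) ⟨ht0.le, ht1⟩
  have h2 : (1 - t) * a + t * r.normConst = b := by
    have : t * (r.normConst - a) = b - a := div_mul_cancel₀ _ hpos.ne'
    linarith
  rw [h2, minEntropy_normConst hr] at h1
  have h3 := mul_pos ht0 (minEntropy_pos hr ha.1 (hab.trans_le hb.2))
  linarith

/-- The values increase to a supremum `c`, and the limiting graphon is feasible at `β` with entropy
at most `c`. -/
theorem tendsto_minEntropy_right (hr : r.BasicAssumption) {β : ℝ} (hβ : 0 ≤ β) :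
    Tendsto (fun n : ℕ => r.minEntropy (β + 1 / ((n : ℝ) + 1))) atTop (𝓝 (r.minEntropy β)) := by
  set b : ℕ → ℝ := fun n => β + 1 / ((n : ℝ) + 1) with hb
  have hanti : Antitone b := fun m n hmn => by
    simp only [hb]
    gcongr
  have hlim : Tendsto b atTop (𝓝 β) := by
    simpa [hb] using (tendsto_one_div_add_atTop_nhds_zero_nat (𝕜 := ℝ)).const_add β
  have hge : ∀ n, β ≤ b n := hanti.le_of_tendsto hlim
  have hmono : Monotone fun n => r.minEntropy (b n) := fun m n hmn =>
    minEntropy_anti hr (hβ.trans (hge n)) (hanti hmn)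
  have hbdd : BddAbove (range fun n => r.minEntropy (b n)) :=
    ⟨r.minEntropy β, by rintro _ ⟨n, rfl⟩; exact minEntropy_anti hr hβ (hge n)⟩
  have hsup := tendsto_atTop_ciSup hmono hbdd
  obtain ⟨g, hg, hgI⟩ := exists_entropy_le_of_tendsto hr hβ hanti hlim (le_ciSup hbdd) hsup
  have heq : ⨆ n, r.minEntropy (b n) = r.minEntropy β :=
    le_antisymm (ciSup_le fun n => minEntropy_anti hr hβ (hge n)) ((minEntropy_le hr hg).trans hgI)
  rwa [heq] at hsup

theorem continuousOn_minEntropy (hr : r.BasicAssumption) :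
    ContinuousOn r.minEntropy (Ici 0) := by
  intro β hβ
  rw [mem_Ici] at hβ
  refine tendsto_order.2 ⟨fun a ha => ?_, fun a ha => ?_⟩
  -- Monotonicity spreads the bound from one point right of `β` to everything left of that point.
  · obtain ⟨n, hn⟩ := ((tendsto_minEntropy_right hr hβ).eventually (lt_mem_nhds ha)).exists
    have h1 : β < β + 1 / ((n : ℝ) + 1) := lt_add_of_pos_right _ (by positivity)
    filter_upwards [self_mem_nhdsWithin, mem_nhdsWithin_of_mem_nhds (Iio_mem_nhds h1)] with b hb hb'
    exact hn.trans_le (minEntropy_anti hr hb (le_of_lt hb'))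
  · rcases hβ.eq_or_lt with rfl | hpos
    · filter_upwards [self_mem_nhdsWithin] with b hb
      exact (minEntropy_anti hr le_rfl hb).trans_lt ha
    -- The chord from `0` to `β`, continued as a constant beyond `β` by `min 1`, is a continuous
    -- upper bound touching at `β`.
    · set F : ℝ → ℝ := fun b => (1 - min 1 (b / β)) * r.minEntropy 0 + min 1 (b / β) * r.minEntropy β
      have hF : Continuous F := by fun_prop
      have hFβ : F β < a := by simpa [F, div_self hpos.ne'] using ha
      filter_upwards [self_mem_nhdsWithin,
        mem_nhdsWithin_of_mem_nhds (hF.continuousAt.eventually (gt_mem_nhds hFβ))] with b hb hb'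
      rw [mem_Ici] at hb
      have ht : min 1 (b / β) ∈ Icc (0 : ℝ) 1 := ⟨le_min zero_le_one (by positivity), min_le_left _ _⟩
      have h1 := minEntropy_convex hr le_rfl hpos.le ht
      rw [mul_zero, zero_add] at h1
      refine lt_of_le_of_lt ((minEntropy_anti hr (mul_nonneg ht.1 hpos.le) ?_).trans h1) hb'
      calc _ ≤ b / β * β := by gcongr; exact min_le_right _ _
        _ = b := div_mul_cancel₀ _ hpos.ne'

end Graphon

/-! ### Passage to the quotient and uniqueness of the minimiser -/

namespace QuotientGraphon

variable {r : Graphon}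

theorem J_nonneg (hr : r.BasicAssumption) (x : QuotientGraphon) : 0 ≤ x.J r :=
  Graphon.rate_nonneg hr _

/-- Relabeling preserves the norm, so the infimum over relabelings merges with the one over feasible
graphons. -/
theorem psi_eq_minEntropy (hr : r.BasicAssumption) {β : ℝ} (hβ : 0 ≤ β) :
    psi r β = r.minEntropy β := by
  refine le_antisymm (le_csInf (Graphon.image_entropy_nonempty r hβ) ?_) (le_csInf ?_ ?_)
  · rintro _ ⟨h, hh, rfl⟩
    have hf : mk h ∈ feasible β := (laplacianNorm_mk h).trans_le hh
    refine (csInf_le ⟨0, ?_⟩ (mem_image_of_mem (J r) hf)).trans ?_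
    · rintro _ ⟨x, -, rfl⟩
      exact J_nonneg hr x
    · exact (J_mk hr h).trans_le (Graphon.rate_le_entropy hr h)
  · exact ⟨_, mem_image_of_mem _ (show (mk 0).laplacianNorm ≤ β by
      rwa [laplacianNorm_mk, Graphon.laplacianNorm_zero])⟩
  · rintro _ ⟨x, hx, rfl⟩
    exact le_ciInf fun φ => Graphon.minEntropy_le hr
      ((Graphon.laplacianNorm_relabel _ φ).trans_le hx)

theorem psi_le_J (hr : r.BasicAssumption) {β : ℝ} {x : QuotientGraphon} (hx : x ∈ feasible β) :
    psi r β ≤ x.J r :=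
  csInf_le ⟨0, by rintro _ ⟨y, -, rfl⟩; exact J_nonneg hr y⟩ (mem_image_of_mem _ hx)

/-- The minimiser is unique, because `I_r` is uniformly convex and the constraint set is convex. -/
theorem exists_minimisers_eq_singleton (hr : r.BasicAssumption) {β : ℝ} (hβ : 0 ≤ β) :
    ∃ x, minimisers r β = {x} := by
  obtain ⟨g, hg, hgI⟩ := Graphon.exists_entropy_eq_minEntropy hr hβ
  have hgf : mk g ∈ feasible β := (laplacianNorm_mk g).trans_le hg
  have hgJ : (mk g).J r ≤ psi r β := by
    rw [J_mk hr, psi_eq_minEntropy hr hβ, ← hgI]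
    exact Graphon.rate_le_entropy hr g
  refine ⟨mk g, Subset.antisymm (fun x hx => ?_) (singleton_subset_iff.2
    ⟨hgf, fun y hy => hgJ.trans (psi_le_J hr hy)⟩)⟩
  have hxJ : r.rate x.rep ≤ r.minEntropy β := by
    rw [← psi_eq_minEntropy hr hβ]
    exact (hx.2 hgf).trans hgJ
  rw [mem_singleton_iff, ← mk_rep x, eq_comm, mk_eq_mk_iff]
  refine le_antisymm (le_of_forall_pos_le_add fun ε hε => ?_) (Graphon.cutMetric_nonneg _ _)
  rw [zero_add]
  -- `J_r` need not be attained within the class, so `φ` is only almost optimal. An excess of `ε² /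
  -- 4` is halved in the midpoint inequality, giving `sqDist / 8 ≤ ε² / 8`.
  obtain ⟨φ, hφ⟩ := exists_lt_of_ciInf_lt (hxJ.trans_lt
    (lt_add_of_pos_right (r.minEntropy β) (by positivity : 0 < ε ^ 2 / 4)))
  have h1 := Graphon.entropy_midpoint hr g (x.rep.relabel φ)
  have h2 : r.minEntropy β ≤ r.entropy (g.mix (x.rep.relabel φ) (1 / 2) Graphon.half_mem_Icc) := by
    refine Graphon.minEntropy_le hr ((Graphon.laplacianNorm_mix_le _ _ _).trans ?_)
    have h3 : (x.rep.relabel φ).laplacianNorm ≤ β :=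
      (Graphon.laplacianNorm_relabel _ φ).trans_le hx.1
    linarith
  refine (Graphon.cutMetric_le _ _ φ).trans ((Graphon.cutDist_le_sqrt_sqDist _ _).trans ?_)
  rw [Real.sqrt_le_left hε.le]
  linarith

end QuotientGraphon

end

theorem theorem1p5 (r : Graphon) (hr : r.BasicAssumption) :
    -- the norm and the rate of a class do not depend on the chosen representative
    (∀ h : Graphon, (QuotientGraphon.mk h).laplacianNorm = h.laplacianNorm) ∧
    (∀ h : Graphon, (QuotientGraphon.mk h).J r = ⨅ φ : Graphon.Relabeling, r.entropy (h.relabel φ)) ∧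
    -- the two forms of the variational formula agree
    (∀ β ∈ Set.Icc 0 r.normConst,
      QuotientGraphon.psi r β = sInf (r.entropy '' {h : Graphon | h.laplacianNorm ≤ β})) ∧
    -- (i)
    ContinuousOn (QuotientGraphon.psi r) (Set.Icc 0 r.normConst) ∧
    StrictAntiOn (QuotientGraphon.psi r) (Set.Icc 0 r.normConst) ∧
    QuotientGraphon.psi r 0 = r.zeroConst ∧
    0 < r.zeroConst ∧
    QuotientGraphon.psi r r.normConst = 0 ∧
    -- (ii)
    (∀ β ∈ Set.Icc 0 r.normConst,
      (QuotientGraphon.minimisers r β).Nonempty ∧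
        IsCompact (QuotientGraphon.minimisers r β)) := by
  have hpsi : EqOn (QuotientGraphon.psi r) r.minEntropy (Icc 0 r.normConst) := fun β hβ =>
    QuotientGraphon.psi_eq_minEntropy hr hβ.1
  refine ⟨QuotientGraphon.laplacianNorm_mk, QuotientGraphon.J_mk hr, hpsi,
    ((Graphon.continuousOn_minEntropy hr).mono Icc_subset_Ici_self).congr hpsi,
    (Graphon.strictAntiOn_minEntropy hr).congr hpsi.symm, ?_, Graphon.zeroConst_pos hr, ?_,
    fun β hβ => ?_⟩
  · rw [QuotientGraphon.psi_eq_minEntropy hr le_rfl, Graphon.minEntropy_zero hr]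
  · rw [QuotientGraphon.psi_eq_minEntropy hr (β := r.normConst) r.laplacianNorm_nonneg,
      Graphon.minEntropy_normConst hr]
  · obtain ⟨x, hx⟩ := QuotientGraphon.exists_minimisers_eq_singleton hr hβ.1
    rw [hx]
    exact ⟨singleton_nonempty x, isCompact_singleton⟩
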